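/- Let $n,n'\ge 0$, let $M\subset\mathbb C^{n+1}$ be a nonempty connected real-analytic (embedded) real hypersurface, and let $U$ be an open neighborhood of $M$ in $\mathbb C^{n+1}$. Let $M'\subset\mathbb C^{n'+1}$ be a nondegenerate hyperquadric, that is, $M'=\{(z,w)\in\mathbb C^{n'}\times\mathbb C:\ \operatorname{Im} w=\langle z,\bar z\rangle\}$ for a nondegenerate hermitian form $\langle\cdot,\cdot\rangle$ on $\mathbb C^{n'}$. For $p\in M$ let $e_0(M,p)$ denote the number of zero eigenvalues (with multiplicity) of a representative $\mathbb C^n\times\mathbb C^n\to\mathbb C$ of the Levi form of $M$ at $p$; it does not depend on the representative. Suppose that $$n'\le 3\bigl(n-e_0(M,p)\bigr)\quad\text{for some point } p\in M .$$ Let $H:U\to\mathbb C^{n'+1}$ be a holomorphic mapping with $H(M)\subset M'$. Then exactly one of the following two conditions holds. (i) There is an open subset $V\subset U$ with $M\subset V$ and $H(V)\subset M'$. (ii) There is a proper real-analytic subset $A\subsetneq M$ such that, for every $p\in M\setminus A$, $H$ is transversal to $M'$ at $H(p)$, i.e. $T_{H(p)}M'+dH(T_p\mathbb C^{n+1})=T_{H(p)}\mathbb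 C^{n'+1}$ (real tangent spaces). Here a subset $A\subset M$ is real-analytic if every point of $M$ has an open neighborhood $W$ in $\mathbb C^{n+1}$ such that $A\cap W$ is the set of common zeros in $M\cap W$ of finitely many real-analytic functions on $W$. -/

import Mathlib

open Filter Topology
open scoped ComplexConjugate

noncomputable section

/-- Complex Euclidean space of dimension `m` (only its topology and its structure of a finite
dimensional complex vector space matter, so the choice of norm is irrelevant). -/
abbrev CSpace (m : ℕ) : Type := Fin m → ℂ

/-- `ρ` is a real-analytic local defining function of the set `S` near the point `p`: it is
real-analytic near `p`, its real differential at `p` is nonzero, and near `p` the set `S`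
is `{ρ = 0}`. -/
def IsLocalDefiningFunction {m : ℕ} (S : Set (CSpace m)) (p : CSpace m) (ρ : CSpace m → ℝ) :
    Prop :=
  AnalyticAt ℝ ρ p ∧ fderiv ℝ ρ p ≠ 0 ∧ ∀ᶠ q in 𝓝 p, (q ∈ S ↔ ρ q = 0)

/-- `S` is an (embedded) real-analytic real hypersurface. -/
def IsRealAnalyticHypersurface {m : ℕ} (S : Set (CSpace m)) : Prop :=
  ∀ p ∈ S, ∃ ρ : CSpace m → ℝ, IsLocalDefiningFunction S p ρ

/-- `A` is a real-analytic subset of the hypersurface `M`: near every point of `M` it is the set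
of common zeros in `M` of finitely many real-analytic functions. -/
def IsRealAnalyticSubset {m : ℕ} (M A : Set (CSpace m)) : Prop :=
  A ⊆ M ∧ ∀ p ∈ M, ∃ (k : ℕ) (f : Fin k → CSpace m → ℝ),
    (∀ i, AnalyticAt ℝ (f i) p) ∧ ∀ᶠ q in 𝓝 p, q ∈ M → (q ∈ A ↔ ∀ i, f i q = 0)

/-- The Wirtinger derivative `∂f/∂Z_j = (∂f/∂x_j - i ∂f/∂y_j) / 2`. -/
def wirtinger {m : ℕ} (j : Fin m) (f : CSpace m → ℂ) (p : CSpace m) : ℂ :=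
  (fderiv ℝ f p (Pi.single j 1) - Complex.I * fderiv ℝ f p (Pi.single j Complex.I)) / 2

/-- The Wirtinger derivative `∂f/∂Z̄_j = (∂f/∂x_j + i ∂f/∂y_j) / 2`. -/
def wirtingerBar {m : ℕ} (j : Fin m) (f : CSpace m → ℂ) (p : CSpace m) : ℂ :=
  (fderiv ℝ f p (Pi.single j 1) + Complex.I * fderiv ℝ f p (Pi.single j Complex.I)) / 2

/-- The space of `(1,0)`-vectors at `p` tangent to `{ρ = 0}`: all `v` with
`∑ j, ρ_{Z_j}(p) v_j = 0`. -/
def holTangentSpace {m : ℕ} (ρ : CSpace m → ℝ) (p : CSpace m) : Submodule ℂ (CSpace m) :=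
  LinearMap.ker (∑ j : Fin m, wirtinger j (fun Z => (ρ Z : ℂ)) p •
    (LinearMap.proj j : CSpace m →ₗ[ℂ] ℂ))

/-- The complex Hessian `∑ j k, ρ_{Z_j Z̄_k}(p) v_j conj(w_k)`; on `holTangentSpace ρ p` it is the
Levi form of `{ρ = 0}` at `p` defined by `ρ`. -/
def leviForm {m : ℕ} (ρ : CSpace m → ℝ) (p v w : CSpace m) : ℂ :=
  ∑ j : Fin m, ∑ k : Fin m,
    wirtinger j (wirtingerBar k (fun Z => (ρ Z : ℂ))) p * v j * conj (w k)

/-- `L` is the matrix of a representative `ℂⁿ × ℂⁿ → ℂ` of the Levi form at `p` of the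
hypersurface `M` in `ℂⁿ⁺¹`: the Levi form defined by some local defining function, in some basis
of the space of tangent `(1,0)`-vectors. -/
def IsLeviRepresentative {n : ℕ} (M : Set (CSpace (n + 1))) (p : CSpace (n + 1))
    (L : Matrix (Fin n) (Fin n) ℂ) : Prop :=
  ∃ ρ : CSpace (n + 1) → ℝ, IsLocalDefiningFunction M p ρ ∧
    ∃ b : Module.Basis (Fin n) ℂ (holTangentSpace ρ p),
      ∀ j k, L j k = leviForm ρ p (b j) (b k)

/-- `e₀(M, p) = e`: the number of zero eigenvalues, with multiplicity, of a representative of the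
Levi form of `M` at `p` is `e`. (It does not depend on the representative.) -/
def LeviZeroEigenvalues {n : ℕ} (M : Set (CSpace (n + 1))) (p : CSpace (n + 1)) (e : ℕ) : Prop :=
  ∃ L : Matrix (Fin n) (Fin n) ℂ, IsLeviRepresentative M p L ∧ L.charpoly.roots.count 0 = e

/-- The hyperquadric `Im w = ∑ j k, A_{jk} z_j conj(z_k)` in `ℂⁿ⁺¹`, with coordinates `(z, w)`,
`w` being the last one. -/
def hyperquadric {n : ℕ} (A : Matrix (Fin n) (Fin n) ℂ) : Set (CSpace (n + 1)) :=
  {Z | ((Z (Fin.last n)).im : ℂ) =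
    ∑ j : Fin n, ∑ k : Fin n, A j k * Z j.castSucc * conj (Z k.castSucc)}

/-- `S` is a nondegenerate hyperquadric: the hyperquadric of a nondegenerate hermitian form. -/
def IsNondegenerateHyperquadric {n : ℕ} (S : Set (CSpace (n + 1))) : Prop :=
  ∃ A : Matrix (Fin n) (Fin n) ℂ, A.IsHermitian ∧ A.det ≠ 0 ∧ S = hyperquadric A

/-- `H` is transversal to the hypersurface `S` at `H p`:
`T_{H p} S + dH(T_p ℂᵐ) = T_{H p} ℂᵐ'`, real tangent spaces, where `T_{H p} S` is the kernel of
the differential of a local defining function of `S` (any one gives the same kernel). -/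
def IsTransversalAt {m m' : ℕ} (H : CSpace m → CSpace m') (S : Set (CSpace m')) (p : CSpace m) :
    Prop :=
  ∃ ρ : CSpace m' → ℝ, IsLocalDefiningFunction S (H p) ρ ∧
    LinearMap.ker (fderiv ℝ ρ (H p)).toLinearMap ⊔
      LinearMap.range (fderiv ℝ H p).toLinearMap = ⊤

end

/-!
# Transversality of holomorphic mappings into hyperquadrics

Let `R = Re ⟨f, f⟩ - Im g` be the defining function of the hyperquadric pulled back by `H = (f, g)`.
The map is transversal at `p ∈ M` if and only if `dR ≠ 0` at `p`, so the only possible exceptional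
set is the real-analytic set `{dR = 0} ∩ M`. If it is not all of `M`, the second alternative holds.
If it is all of `M`, then `R` has to vanish identically near `M`; by unique continuation along the
connected set `M` it suffices to see this near one point, and a point `p` where the Levi form has
rank `r` with `n' ≤ 3 r` will do (`eventuallyEq_zero_of_fderiv_eq_zero`).

Suppose `R` is not zero near `p`. At a nearby point of `M`, again called `p`, where the order of
vanishing of `R` along `M` is least, `R` equals `c ρ ^ k` to leading order, with `c ≠ 0` and `ρ` a
defining function of `M` (`AnalyticAt.exists_order_along`, `AnalyticAt.exists_isBigO_sub_mul_pow`);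
here `k ≥ 2` because `dR = 0` along `M`. The Levi form still has rank at least `r` at the new point
(`IsLeviOrthogonal.eventually_exists`). Choose complex tangent vectors `v i`, `i < r`,
diagonalizing it with nonzero eigenvalues `ℓ i`, and a transverse vector `e`. On the holomorphic
curve `γ s = p + ∑ i, s ^ d i v i + (s ^ D - q(s)) e` with `D = 2 m`, `d i = m + 2 ^ i` and `m`
large, where `q` is chosen to cancel the pluriharmonic second order terms of `ρ`, one gets
`R (γ s) = c (s ^ D + conj s ^ D + ∑ i, ℓ i |s| ^ (2 d i)) ^ k + O(|s| ^ (2 m k + m))`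
(`IsLeviOrthogonal.isBigO_comp_leviCurve`).

On the other hand `R (γ s) = ⟨F, F⟩ - Im G` with `F = f ∘ γ = ∑ a, F_a s ^ a`, so the coefficient of
`s ^ a * conj s ^ b` in the polynomial above is `⟨F_a, F_b⟩` as long as `a, b ≥ 1` and
`a + b < 2 m k + m` (`sum_mul_coeff_mul_conj_coeff_eq`). The exponents are chosen so that different
monomials in the variables `s ^ d i` and `s ^ D` have different degrees, and the Gram matrix of the
`3 r + 1` vectors `F_a ∈ ℂ ^ n'` with index `a = d i`, `D`, `2 d i` or `(k - 1) D + d i` against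
those with index `(k - 1) D + d i`, `(k - 1) D`, `(k - 2) D + 2 d i`, `d i` is triangular with
nonzero diagonal. Hence these vectors are independent (`three_mul_add_one_le_card`) and
`n' ≥ 3 r + 1`, a contradiction.

Analyticity of `H`, which is only assumed complex differentiable, is Osgood's lemma,
`DifferentiableOn.analyticAt_of_finiteDimensional`.
-/

/-! ### Holomorphic functions of several variables are analytic -/

/-- **Cauchy's estimate** for the Fréchet derivative of a holomorphic map of several variables. -/
theorem norm_fderiv_le_of_norm_le_on_closedBall {E F : Type*} [NormedAddCommGroup E]
    [NormedSpace ℂ E] [NormedAddCommGroup F] [NormedSpace ℂ F] {f : E → F} {s : Set E} {x : E}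
    {δ C : ℝ} (hδ : 0 < δ) (hs : Metric.closedBall x δ ⊆ s) (hso : IsOpen s)
    (hf : DifferentiableOn ℂ f s) (hC : ∀ y ∈ Metric.closedBall x δ, ‖f y‖ ≤ C) :
    ‖fderiv ℂ f x‖ ≤ C / δ := by
  have hC0 : 0 ≤ C := (norm_nonneg _).trans (hC x (Metric.mem_closedBall_self hδ.le))
  refine ContinuousLinearMap.opNorm_le_bound _ (by positivity) fun v => ?_
  rcases eq_or_ne v 0 with rfl | hv
  · simp
  have hv' : 0 < ‖v‖ := norm_pos_iff.2 hv
  have ht : 0 < δ / ‖v‖ := by positivity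
  have hmem : ∀ ζ : ℂ, ‖ζ‖ ≤ δ / ‖v‖ → x + ζ • v ∈ Metric.closedBall x δ := by
    intro ζ hζ
    rw [mem_closedBall_iff_norm, add_sub_cancel_left, norm_smul]
    rwa [le_div_iff₀ hv'] at hζ
  have hline : ∀ ζ : ℂ, HasDerivAt (fun ζ : ℂ => x + ζ • v) v ζ := fun ζ => by
    simpa using ((hasDerivAt_id ζ).smul_const v).const_add x
  have hdiff : ∀ ζ : ℂ, ‖ζ‖ ≤ δ / ‖v‖ →
      HasDerivAt (fun ζ : ℂ => f (x + ζ • v)) (fderiv ℂ f (x + ζ • v) v) ζ := fun ζ hζ =>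
    ((hf.differentiableAt (hso.mem_nhds (hs (hmem ζ hζ)))).hasFDerivAt).comp_hasDerivAt ζ (hline ζ)
  have hd : deriv (fun ζ : ℂ => f (x + ζ • v)) 0 = fderiv ℂ f x v := by
    simpa using (hdiff 0 (by simpa using ht.le)).deriv
  have key := Complex.norm_deriv_le_of_forall_mem_sphere_norm_le (c := 0) (C := C)
    (f := fun ζ : ℂ => f (x + ζ • v)) ht
    (DifferentiableOn.diffContOnCl fun ζ hζ => by
      rw [closure_ball _ ht.ne', mem_closedBall_zero_iff] at hζ
      exact (hdiff ζ hζ).differentiableAt.differentiableWithinAt)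
    (fun ζ hζ => hC _ (hmem ζ (by rw [mem_sphere_zero_iff_norm] at hζ; exact hζ.le)))
  rw [hd] at key
  calc ‖fderiv ℂ f x v‖ ≤ C / (δ / ‖v‖) := key
    _ = C / δ * ‖v‖ := by field_simp

/-- A directional derivative of a holomorphic function of several variables is holomorphic:
differentiate Cauchy's formula on a small circle in the given direction under the integral. -/
theorem DifferentiableOn.fderiv_apply_of_complex {E : Type*} [NormedAddCommGroup E]
    [NormedSpace ℂ E] [FiniteDimensional ℂ E] {f : E → ℂ} {U : Set E} (hU : IsOpen U)
    (hf : DifferentiableOn ℂ f U) (v : E) :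
    DifferentiableOn ℂ (fun x => fderiv ℂ f x v) U := by
  intro x₀ hx₀
  refine DifferentiableAt.differentiableWithinAt ?_
  let _ : MeasurableSpace E := borel E
  have : BorelSpace E := ⟨rfl⟩
  have : SecondCountableTopology E := by
    have : ProperSpace E := FiniteDimensional.proper ℂ E
    infer_instance
  have hcont : ContinuousAt f x₀ := (hf.differentiableAt (hU.mem_nhds hx₀)).continuousAt
  have hev : ∀ᶠ y in 𝓝 x₀, y ∈ U ∧ ‖f y‖ < ‖f x₀‖ + 1 :=
    (hU.eventually_mem hx₀).and
      (hcont.norm.eventually_lt continuousAt_const (by simp))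
  obtain ⟨R, hR, hball⟩ := Metric.eventually_nhds_iff_ball.1 hev
  set δ := R / 4 with hδ
  have hδ0 : 0 < δ := by positivity
  set ε := δ / (‖v‖ + 1) with hε
  have hε0 : 0 < ε := by positivity
  have hεv : ε * ‖v‖ ≤ δ := by
    rw [hε, div_mul_eq_mul_div, div_le_iff₀ (by positivity)]
    nlinarith [norm_nonneg v]
  have hshift : ∀ x ∈ Metric.ball x₀ δ, ∀ ζ : ℂ, ‖ζ‖ ≤ ε →
      x + ζ • v ∈ Metric.ball x₀ (2 * δ) := by
    intro x hx ζ hζ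
    rw [mem_ball_iff_norm] at hx ⊢
    have h1 : ‖ζ • v‖ ≤ δ := by
      rw [norm_smul]
      exact (mul_le_mul_of_nonneg_right hζ (norm_nonneg _)).trans hεv
    calc ‖x + ζ • v - x₀‖ = ‖(x - x₀) + ζ • v‖ := by congr 1; abel
      _ ≤ ‖x - x₀‖ + ‖ζ • v‖ := norm_add_le _ _
      _ < 2 * δ := by linarith
  have hbound : ∀ y ∈ Metric.ball x₀ (2 * δ), ‖fderiv ℂ f y‖ ≤ (‖f x₀‖ + 1) / δ := by
    intro y hy
    have hsub : Metric.closedBall y δ ⊆ Metric.ball x₀ R := by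
      intro z hz
      rw [mem_closedBall_iff_norm] at hz
      rw [mem_ball_iff_norm] at hy ⊢
      have : ‖z - x₀‖ ≤ ‖z - y‖ + ‖y - x₀‖ := by
        simpa using norm_add_le (z - y) (y - x₀)
      linarith
    exact norm_fderiv_le_of_norm_le_on_closedBall hδ0 (s := U)
      (fun z hz => (hball z (hsub hz)).1) hU hf (fun z hz => (hball z (hsub hz)).2.le)
  have hdiffat : ∀ y ∈ Metric.ball x₀ (2 * δ), DifferentiableAt ℂ f y := fun y hy =>
    hf.differentiableAt (hU.mem_nhds (hball y (Metric.ball_subset_ball (by linarith) hy)).1)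
  have hc : ∀ θ : ℝ, ‖circleMap 0 ε θ‖ ≤ ε := fun θ => by
    simp [abs_of_pos hε0]
  have hcauchy : ∀ x ∈ Metric.ball x₀ δ, fderiv ℂ f x v =
      (2 * ↑Real.pi * Complex.I)⁻¹ • ∮ z in C(0, ε), ((z - 0) ^ 2)⁻¹ • f (x + z • v) := by
    intro x hx
    have hline : ∀ ζ : ℂ, HasDerivAt (fun ζ : ℂ => x + ζ • v) v ζ := fun ζ => by
      simpa using ((hasDerivAt_id ζ).smul_const v).const_add x
    have hopen : IsOpen ((fun ζ : ℂ => x + ζ • v) ⁻¹' Metric.ball x₀ (2 * δ)) :=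
      Metric.isOpen_ball.preimage (by fun_prop)
    have hd : ∀ ζ ∈ (fun ζ : ℂ => x + ζ • v) ⁻¹' Metric.ball x₀ (2 * δ),
        HasDerivAt (fun ζ : ℂ => f (x + ζ • v)) (fderiv ℂ f (x + ζ • v) v) ζ := fun ζ hζ =>
      (hdiffat _ hζ).hasFDerivAt.comp_hasDerivAt ζ (hline ζ)
    rw [Complex.two_pi_I_inv_smul_circleIntegral_sub_sq_inv_smul_of_differentiable hopen
      (fun ζ hζ => hshift x hx ζ (by simpa using hζ))
      (fun ζ hζ => (hd ζ hζ).differentiableAt.differentiableWithinAt)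
      (Metric.mem_ball_self hε0)]
    have h0 := (hd 0 (hshift x hx 0 (by simpa using hε0.le))).deriv
    rw [h0]
    simp
  have hcont' : ∀ x ∈ Metric.ball x₀ δ, Continuous fun θ : ℝ => f (x + circleMap 0 ε θ • v) := by
    intro x hx
    refine continuous_iff_continuousAt.2 fun θ => ?_
    exact ContinuousAt.comp (f := fun θ : ℝ => x + circleMap 0 ε θ • v) (g := f)
      (hdiffat _ (hshift x hx _ (hc θ))).continuousAt
      (by have := continuous_circleMap 0 ε; fun_prop)
  set w : ℝ → ℂ := fun θ => _root_.deriv (circleMap 0 ε) θ * ((circleMap 0 ε θ - 0) ^ 2)⁻¹ with hw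
  have hwc : Continuous w := by
    have h1 := continuous_circleMap 0 ε
    have h2 : ∀ θ, (circleMap 0 ε θ - 0) ^ 2 ≠ 0 := fun θ => by
      simpa using hε0.ne'
    simp only [hw, deriv_circleMap]
    exact (h1.mul continuous_const).mul (((h1.sub continuous_const).pow 2).inv₀ h2)
  have hwn : ∀ θ, ‖w θ‖ = ε⁻¹ := by
    intro θ
    simp only [hw, deriv_circleMap, sub_zero, norm_mul, norm_inv, norm_pow, norm_circleMap_zero,
      Complex.norm_I, abs_of_pos hε0]
    field_simp
  have hint : HasFDerivAt (fun x => ∫ θ in Set.Ioc 0 (2 * Real.pi), w θ * f (x + circleMap 0 ε θ • v))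
      (∫ θ in Set.Ioc 0 (2 * Real.pi), w θ • fderiv ℂ f (x₀ + circleMap 0 ε θ • v)) x₀ := by
    have hmem : Metric.ball x₀ δ ∈ 𝓝 x₀ := Metric.ball_mem_nhds _ hδ0
    refine hasFDerivAt_integral_of_dominated_of_fderiv_le
      (F' := fun x θ => w θ • fderiv ℂ f (x + circleMap 0 ε θ • v))
      (bound := fun _ => ε⁻¹ * ((‖f x₀‖ + 1) / δ)) hmem ?_ ?_ ?_ ?_ ?_ ?_
    · filter_upwards [hmem] with x hx
      exact (hwc.mul (hcont' x hx)).aestronglyMeasurable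
    · exact (((hwc.mul (hcont' x₀ (Metric.mem_ball_self hδ0))).continuousOn).integrableOn_Icc
        (a := 0) (b := 2 * Real.pi)).mono_set Set.Ioc_subset_Icc_self
    · refine (hwc.aestronglyMeasurable).smul ?_
      have hm : Measurable fun θ : ℝ => fderiv ℂ f (x₀ + circleMap 0 ε θ • v) :=
        (measurable_fderiv ℂ f).comp (by
          have := continuous_circleMap 0 ε
          exact (by fun_prop : Continuous fun θ : ℝ => x₀ + circleMap 0 ε θ • v).measurable)
      exact hm.aestronglyMeasurable
    · refine Eventually.of_forall fun θ x hx => ?_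
      rw [norm_smul, hwn]
      gcongr
      exact hbound _ (hshift x hx _ (hc θ))
    · exact MeasureTheory.integrableOn_const measure_Ioc_lt_top.ne
    · refine Eventually.of_forall fun θ x hx => ?_
      have h1 : HasFDerivAt (fun x => x + circleMap 0 ε θ • v) (ContinuousLinearMap.id ℂ E) x :=
        (hasFDerivAt_id x).add_const _
      have h2 := ((hdiffat _ (hshift x hx _ (hc θ))).hasFDerivAt.comp x h1).const_mul (w θ)
      simpa using h2
  have hfin : DifferentiableAt ℂ (fun x => (2 * ↑Real.pi * Complex.I)⁻¹ •
      ∫ θ in Set.Ioc 0 (2 * Real.pi), w θ * f (x + circleMap 0 ε θ • v)) x₀ :=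
    hint.differentiableAt.fun_const_smul _
  refine hfin.congr_of_eventuallyEq ?_
  filter_upwards [Metric.ball_mem_nhds x₀ hδ0] with x hx
  rw [hcauchy x hx, circleIntegral, intervalIntegral.integral_of_le (by positivity)]
  simp only [hw, smul_eq_mul, mul_assoc]

/-- Holomorphic functions of several variables are smooth. -/
theorem DifferentiableOn.contDiffOn_of_complex {E : Type*} [NormedAddCommGroup E]
    [NormedSpace ℂ E] [FiniteDimensional ℂ E] {f : E → ℂ} {U : Set E} (hU : IsOpen U)
    (hf : DifferentiableOn ℂ f U) (n : ℕ) : ContDiffOn ℂ n f U := by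
  induction n generalizing f with
  | zero => simpa using hf.continuousOn
  | succ n ih =>
    have h : ContDiffOn ℂ ((n : WithTop ℕ∞) + 1) f U := by
      rw [contDiffOn_succ_iff_fderiv_of_isOpen hU]
      refine ⟨hf, by simp, contDiffOn_clm_apply.2 fun v => ih (hf.fderiv_apply_of_complex hU v)⟩
    exact_mod_cast h

/-- Iterating Cauchy's estimate over `n` concentric balls whose radii drop by `δ` bounds the
`n`-th derivative. -/
theorem norm_iteratedFDeriv_le_of_norm_le_on_closedBall {E : Type*} [NormedAddCommGroup E]
    [NormedSpace ℂ E] {f : E → ℂ} {U : Set E} (hU : IsOpen U)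
    (hf : ∀ n : ℕ, ContDiffOn ℂ n f U) {x : E} {R δ C : ℝ} (hδ : 0 < δ)
    (hR : Metric.closedBall x R ⊆ U) (hC : ∀ y ∈ Metric.closedBall x R, ‖f y‖ ≤ C) (n : ℕ) :
    ∀ y ∈ Metric.closedBall x (R - n * δ), ‖iteratedFDeriv ℂ n f y‖ ≤ C / δ ^ n := by
  induction n with
  | zero => simpa using hC
  | succ n ih =>
    intro y hy
    rw [← norm_fderiv_iteratedFDeriv, pow_succ, ← div_div]
    refine norm_fderiv_le_of_norm_le_on_closedBall (s := U) hδ ?_ hU ?_ ?_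
    · refine fun z hz => hR ?_
      rw [mem_closedBall_iff_norm] at *
      have := norm_add_le (z - y) (y - x)
      rw [sub_add_sub_cancel] at this
      push_cast at hy
      nlinarith [Nat.cast_nonneg (α := ℝ) n]
    · intro z hz
      refine DifferentiableAt.differentiableWithinAt ?_
      have : ContDiffAt ℂ ((n + 1 : ℕ) : WithTop ℕ∞) f z :=
        (hf (n + 1)).contDiffAt (hU.mem_nhds hz)
      exact this.differentiableAt_iteratedFDeriv (by exact_mod_cast Nat.lt_succ_self n)
    · refine fun z hz => ih z ?_
      rw [mem_closedBall_iff_norm] at *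
      have := norm_add_le (z - y) (y - x)
      rw [sub_add_sub_cancel] at this
      push_cast at hy
      linarith

theorem iteratedDeriv_comp_line_eq {E : Type*} [NormedAddCommGroup E]
    [NormedSpace ℂ E] {f : E → ℂ} {U : Set E} (hU : IsOpen U)
    (hf : ∀ n : ℕ, ContDiffOn ℂ n f U) (x y : E) (n : ℕ) :
    ∀ t : ℂ, x + t • y ∈ U → iteratedDeriv n (fun t : ℂ => f (x + t • y)) t =
      iteratedFDeriv ℂ n f (x + t • y) fun _ => y := by
  induction n with
  | zero => intro t _; simp
  | succ n ih =>
    intro t ht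
    have hopen : IsOpen ((fun t : ℂ => x + t • y) ⁻¹' U) := hU.preimage (by fun_prop)
    rw [iteratedDeriv_succ]
    have he : iteratedDeriv n (fun t : ℂ => f (x + t • y)) =ᶠ[𝓝 t]
        fun t => iteratedFDeriv ℂ n f (x + t • y) fun _ => y := by
      filter_upwards [hopen.mem_nhds ht] with u hu using ih u hu
    rw [he.deriv_eq]
    have hline : HasDerivAt (fun t : ℂ => x + t • y) y t := by
      simpa using ((hasDerivAt_id t).smul_const y).const_add x
    have hD : DifferentiableAt ℂ (iteratedFDeriv ℂ n f) (x + t • y) :=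
      ((hf (n + 1)).contDiffAt (hU.mem_nhds ht)).differentiableAt_iteratedFDeriv
        (by exact_mod_cast Nat.lt_succ_self n)
    have h1 := hD.hasFDerivAt.comp_hasDerivAt t hline
    have h2 := (ContinuousMultilinearMap.apply ℂ (fun _ : Fin n => E) ℂ
      (fun _ => y)).hasFDerivAt.comp_hasDerivAt t h1
    have h3 := h2.deriv
    rw [iteratedFDeriv_succ_apply_left]
    exact h3

/-- **Osgood's lemma**: complex differentiable functions of several variables are analytic. -/
theorem DifferentiableOn.analyticAt_of_finiteDimensional {E : Type*} [NormedAddCommGroup E]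
    [NormedSpace ℂ E] [FiniteDimensional ℂ E] {f : E → ℂ} {U : Set E} (hU : IsOpen U)
    (hf : DifferentiableOn ℂ f U) {x : E} (hx : x ∈ U) : AnalyticAt ℂ f x := by
  have hsm := hf.contDiffOn_of_complex hU
  have hcont : ContinuousAt f x := (hf.differentiableAt (hU.mem_nhds hx)).continuousAt
  have hev : ∀ᶠ y in 𝓝 x, y ∈ U ∧ ‖f y‖ < ‖f x‖ + 1 :=
    (hU.eventually_mem hx).and (hcont.norm.eventually_lt continuousAt_const (by simp))
  obtain ⟨R, hR, hball⟩ := Metric.nhds_basis_closedBall.eventually_iff.1 hev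
  set C := ‖f x‖ + 1 with hCdef
  have hest : ∀ n : ℕ, ‖iteratedFDeriv ℂ n f x‖ ≤ C * (n / R) ^ n := by
    intro n
    rcases Nat.eq_zero_or_pos n with rfl | hn
    · simp [hCdef]
    have hn' : (0 : ℝ) < n := by exact_mod_cast hn
    have := norm_iteratedFDeriv_le_of_norm_le_on_closedBall hU hsm (δ := R / n) (C := C)
      (by positivity) (fun y hy => (hball hy).1) (fun y hy => (hball hy).2.le) n x
      (by simp [mul_div_cancel₀, hn'.ne'])
    rwa [div_eq_mul_inv, ← inv_pow, inv_div] at this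
  set p : FormalMultilinearSeries ℂ E ℂ := fun n =>
    ((n.factorial : ℂ)⁻¹) • iteratedFDeriv ℂ n f x with hp
  set r : NNReal := ⟨R / Real.exp 1, by positivity⟩ with hr
  have hr0 : (0 : ℝ) < r := by
    change 0 < R / Real.exp 1
    positivity
  have hrR : 2 * (r : ℝ) ≤ R := by
    change 2 * (R / Real.exp 1) ≤ R
    rw [mul_div_assoc', div_le_iff₀ (Real.exp_pos 1)]
    nlinarith [Real.add_one_le_exp 1]
  refine ⟨p, r, ⟨?_, by exact_mod_cast hr0, ?_⟩⟩
  · refine p.le_radius_of_bound C fun n => ?_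
    have hfac := Real.pow_div_factorial_le_exp n (Nat.cast_nonneg n) n
    have hC0 : 0 ≤ C := by positivity
    have hrr : (r : ℝ) = R / Real.exp 1 := rfl
    have hexp : Real.exp (n : ℝ) = Real.exp 1 ^ n := by
      rw [← Real.exp_nat_mul, mul_one]
    calc ‖p n‖ * (r : ℝ) ^ n ≤ ((n.factorial : ℝ)⁻¹ * (C * (n / R) ^ n)) * (r : ℝ) ^ n := by
          gcongr
          rw [hp]
          simp only
          rw [norm_smul]
          gcongr
          · simp
          · exact hest n
      _ = C * ((n : ℝ) ^ n / n.factorial) * (Real.exp 1 ^ n)⁻¹ := by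
          rw [hrr, div_pow, div_pow]
          field_simp
      _ ≤ C * Real.exp 1 ^ n * (Real.exp 1 ^ n)⁻¹ := by
          rw [← hexp]
          gcongr
      _ = C := by
          field_simp
  · intro y hy
    have hy' : ‖y‖ < r := by simpa using hy
    have hmem : ∀ t : ℂ, ‖t‖ < 2 → x + t • y ∈ Metric.closedBall x R := by
      intro t ht
      rw [mem_closedBall_iff_norm, add_sub_cancel_left, norm_smul]
      nlinarith [norm_nonneg y, norm_nonneg t]
    have hd : DifferentiableOn ℂ (fun t : ℂ => f (x + t • y)) (Metric.ball 0 2) := by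
      intro t ht
      refine DifferentiableAt.differentiableWithinAt ?_
      have hU' := (hball (hmem t (by simpa using ht))).1
      exact DifferentiableAt.comp (f := fun t : ℂ => x + t • y) t
        (hf.differentiableAt (hU.mem_nhds hU')) (by fun_prop)
    have hsum := Complex.hasSum_taylorSeries_on_ball hd (z := 1) (by simp)
    have hx0 : x + (0 : ℂ) • y ∈ U := by simpa using hx
    simp only [iteratedDeriv_comp_line_eq hU hsm x y _ 0 hx0, sub_zero, one_pow, one_smul,
      zero_smul, add_zero] at hsum
    exact hsum

/-! ### Polynomials in a complex variable and its conjugate -/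

open Polynomial in
theorem Polynomial.coeff_eq_zero_of_isBigO {R : ℂ[X]} {N : ℕ}
    (h : (fun t : ℝ => R.eval (t : ℂ)) =O[𝓝 0] fun t => ‖t‖ ^ N) :
    ∀ m < N, R.coeff m = 0 := by
  intro m
  induction m using Nat.strong_induction_on with
  | _ m ih =>
    intro hm
    obtain ⟨S, rfl⟩ := X_pow_dvd_iff.2 fun d hd => ih d hd (hd.trans hm)
    have hS : Tendsto (fun t : ℝ => S.eval (t : ℂ)) (𝓝[≠] 0) (𝓝 0) := by
      have h1 : (fun t : ℝ => S.eval (t : ℂ)) =O[𝓝[≠] 0] fun t => ‖t‖ ^ (N - m) := by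
        obtain ⟨C, hC⟩ := h.bound
        refine Asymptotics.IsBigO.of_bound C ?_
        filter_upwards [hC.filter_mono nhdsWithin_le_nhds, self_mem_nhdsWithin] with t ht ht0
        have ht0' : 0 < ‖t‖ := norm_pos_iff.2 ht0
        have e : ‖t‖ ^ N = ‖t‖ ^ m * ‖t‖ ^ (N - m) := by rw [← pow_add]; congr 1; omega
        simp only [eval_mul, eval_pow, eval_X, norm_mul, norm_pow, Complex.norm_real, norm_norm,
          e] at ht ⊢
        have : ‖t‖ ^ m * ‖S.eval (t : ℂ)‖ ≤ ‖t‖ ^ m * (C * ‖t‖ ^ (N - m)) := by linarith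
        exact le_of_mul_le_mul_left this (by positivity)
      refine h1.trans_tendsto ?_
      have : Tendsto (fun t : ℝ => ‖t‖ ^ (N - m)) (𝓝 0) (𝓝 (‖(0 : ℝ)‖ ^ (N - m))) :=
        (by fun_prop : Continuous fun t : ℝ => ‖t‖ ^ (N - m)).tendsto 0
      rw [norm_zero, zero_pow (by omega)] at this
      exact this.mono_left nhdsWithin_le_nhds
    have hS' : Tendsto (fun t : ℝ => S.eval (t : ℂ)) (𝓝[≠] 0) (𝓝 (S.eval ((0 : ℝ) : ℂ))) :=
      ((by fun_prop : Continuous fun t : ℝ => S.eval (t : ℂ)).tendsto 0).mono_left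
        nhdsWithin_le_nhds
    have := tendsto_nhds_unique hS' hS
    rw [coeff_X_pow_mul', if_pos le_rfl, Nat.sub_self, coeff_zero_eq_eval_zero]
    simpa using this

/-- A polynomial in `s` and `conj s` (outer variable `s`, inner variable `conj s`) that vanishes to
order `N` at `0` has no monomials of total degree less than `N`: on each ray `s = t * ω` compare
powers of `t`, then vary `ω` on the unit circle. -/
theorem Polynomial.coeff_coeff_eq_zero_of_isBigO {Q : Polynomial (Polynomial ℂ)} {N : ℕ}
    (h : (fun s : ℂ => Q.evalEval (conj s) s) =O[𝓝 0] fun s => ‖s‖ ^ N) {a b : ℕ}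
    (hab : a + b < N) : (Q.coeff a).coeff b = 0 := by
  set m := a + b with hm
  set W : Polynomial ℂ := ∑ i ∈ Finset.range (m + 1),
    C ((Q.coeff i).coeff (m - i)) * X ^ (2 * i) with hW
  have hroot : ∀ ω ∈ Metric.sphere (0 : ℂ) 1, W.eval ω = 0 := by
    intro ω hω
    have hω1 : ‖ω‖ = 1 := by simpa using hω
    have hωc : ω * conj ω = 1 := by
      rw [Complex.mul_conj, Complex.normSq_eq_norm_sq, hω1]; simp
    set R : Polynomial ℂ := Q.eval₂ (compRingHom (C (conj ω) * X)) (C ω * X) with hR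
    have heval : ∀ t : ℝ, R.eval (t : ℂ) = Q.evalEval (conj (ω * t)) (ω * t) := by
      intro t
      have h1 : R.eval (t : ℂ) = Q.eval₂
          ((evalRingHom (t : ℂ)).comp (compRingHom (C (conj ω) * X))) (ω * t) := by
        rw [hR, ← coe_evalRingHom, hom_eval₂]
        simp
      rw [h1, ← coe_evalEvalRingHom, evalEvalRingHom_eq]
      simp only [coe_eval₂RingHom]
      congr 1
      ext x <;> simp
    have hO : (fun t : ℝ => R.eval (t : ℂ)) =O[𝓝 0] fun t => ‖t‖ ^ N := by
      have ht : Tendsto (fun t : ℝ => ω * (t : ℂ)) (𝓝 0) (𝓝 0) := by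
        have := (by fun_prop : Continuous fun t : ℝ => ω * (t : ℂ)).tendsto 0
        simpa using this
      have := h.comp_tendsto ht
      refine (this.congr_left fun t => (heval t).symm).congr_right fun t => ?_
      simp [hω1]
    have hc := Polynomial.coeff_eq_zero_of_isBigO hO m hab
    have hcoef : R.coeff m = ∑ i ∈ Finset.range (m + 1),
        (Q.coeff i).coeff (m - i) * conj ω ^ (m - i) * ω ^ i := by
      have hsum : ∀ i, ((Q.coeff i).comp (C (conj ω) * X) * (C ω * X) ^ i).coeff m =
          if i ≤ m then (Q.coeff i).coeff (m - i) * conj ω ^ (m - i) * ω ^ i else 0 := by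
        intro i
        rw [mul_pow, ← C_pow, ← mul_assoc, coeff_mul_X_pow']
        split_ifs
        · rw [coeff_mul_C, comp_C_mul_X_coeff]
        · rfl
      rw [hR, eval₂_eq_sum_range' _ (n := max (Q.natDegree + 1) (m + 1)) (by simp),
        finsetSum_coeff]
      simp only [coe_compRingHom, hsum]
      rw [← Finset.sum_filter]
      refine Finset.sum_congr ?_ fun _ _ => rfl
      ext i
      simp
      omega
    rw [hcoef] at hc
    have : W.eval ω = ω ^ m * ∑ i ∈ Finset.range (m + 1),
        (Q.coeff i).coeff (m - i) * conj ω ^ (m - i) * ω ^ i := by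
      rw [hW, eval_finsetSum, Finset.mul_sum]
      refine Finset.sum_congr rfl fun i hi => ?_
      have hi' : i ≤ m := by simpa [Nat.lt_succ_iff] using hi
      have e1 : ω ^ m = ω ^ (m - i) * ω ^ i := by rw [← pow_add]; congr 1; omega
      have e2 : ω ^ (m - i) * conj ω ^ (m - i) = 1 := by rw [← mul_pow, hωc, one_pow]
      simp only [eval_mul, eval_C, eval_pow, eval_X]
      rw [e1, two_mul, pow_add]
      linear_combination (-(Q.coeff i).coeff (m - i) * ω ^ i * ω ^ i) * e2
    rw [this, hc, mul_zero]
  have hinf : (Metric.sphere (0 : ℂ) 1).Infinite := by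
    refine (isPreconnected_sphere (by simp [Complex.rank_real_complex]) (0 : ℂ) 1).infinite_of_nontrivial
      ⟨1, by simp, -1, by simp, ?_⟩
    norm_num [Complex.ext_iff]
  have hW0 : W = 0 := eq_zero_of_infinite_isRoot _ (hinf.mono hroot)
  have := congrArg (fun p : Polynomial ℂ => p.coeff (2 * a)) hW0
  simp only [hW, finsetSum_coeff, coeff_C_mul_X_pow, coeff_zero] at this
  rw [Finset.sum_eq_single a] at this
  · simpa [hm] using this
  · intro i _ hi
    rw [if_neg (by omega)]
  · intro ha
    exact absurd (Finset.mem_range.2 (by omega)) ha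

open Polynomial in
theorem AnalyticAt.exists_polynomial_isBigO {F : ℂ → ℂ} (hF : AnalyticAt ℂ F 0) (N : ℕ) :
    ∃ T : ℂ[X], (fun s => F s - T.eval s) =O[𝓝 0] fun s => ‖s‖ ^ N := by
  obtain ⟨p, hp⟩ := hF
  refine ⟨∑ i ∈ Finset.range N, C (p.coeff i) * X ^ i, ?_⟩
  have := hp.isBigO_sub_partialSum_pow N
  simp only [zero_add] at this
  refine this.congr_left fun s => ?_
  simp only [FormalMultilinearSeries.partialSum, eval_finsetSum, eval_mul, eval_C, eval_pow, eval_X,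
    FormalMultilinearSeries.apply_eq_pow_smul_coeff, smul_eq_mul, mul_comm]

open Polynomial in
theorem Polynomial.conj_eval (T : ℂ[X]) (s : ℂ) :
    conj (T.eval s) = (T.map (starRingEnd ℂ)).eval (conj s) := by
  rw [eval_map, eval₂_hom]

open Polynomial in
/-- If `⟨F, F⟩ - Im G`, for a sesquilinear form with matrix `A` and holomorphic `F` and `G` of one
variable `s`, agrees to order `N` with a polynomial `Q` in `s` and `conj s`, then the pairings of
the Taylor coefficients of `F` are the mixed coefficients of `Q` of total degree less than `N`;
the pluriharmonic term `Im G` contributes to pure powers only. -/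
theorem sum_mul_coeff_mul_conj_coeff_eq {ι : Type*} [Fintype ι] {A : Matrix ι ι ℂ}
    {F : ι → ℂ → ℂ} {G : ℂ → ℂ} {T : ι → ℂ[X]} {S : ℂ[X]} {Q : Polynomial ℂ[X]} {N : ℕ}
    (hF : ∀ j, ContinuousAt (F j) 0)
    (hT : ∀ j, (fun s => F j s - (T j).eval s) =O[𝓝 0] fun s => ‖s‖ ^ N)
    (hS : (fun s => G s - S.eval s) =O[𝓝 0] fun s => ‖s‖ ^ N)
    (hQ : (fun s => (∑ j, ∑ k, A j k * F j s * conj (F k s)) - ((G s).im : ℂ) -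
      Q.evalEval (conj s) s) =O[𝓝 0] fun s => ‖s‖ ^ N)
    {a b : ℕ} (ha : 1 ≤ a) (hb : 1 ≤ b) (hab : a + b < N) :
    ∑ j, ∑ k, A j k * (T j).coeff a * conj ((T k).coeff b) = (Q.coeff a).coeff b := by
  have hconj : ∀ {f : ℂ → ℂ}, f =O[𝓝 0] (fun s => ‖s‖ ^ N) →
      (fun s => conj (f s)) =O[𝓝 0] fun s : ℂ => ‖s‖ ^ N := fun {f} hf =>
    (Asymptotics.IsBigO.of_norm_left (f' := fun s => conj (f s)) (by simpa using hf.norm_left))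
  set P : Polynomial ℂ[X] := (∑ j, ∑ k, C (C (A j k)) * (T j).map C *
    C ((T k).map (starRingEnd ℂ))) - C (C (1 / (2 * Complex.I))) *
      (S.map C - C (S.map (starRingEnd ℂ))) - Q with hP
  have him : ∀ z : ℂ, (z.im : ℂ) = 1 / (2 * Complex.I) * (z - conj z) := by
    intro z
    rw [Complex.sub_conj]
    push_cast
    field_simp
  have hPeval : ∀ s, P.evalEval (conj s) s = (∑ j, ∑ k, A j k * (T j).eval s *
      conj ((T k).eval s)) - (((S.eval s).im : ℝ) : ℂ) - Q.evalEval (conj s) s := by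
    intro s
    rw [him]
    simp only [hP, evalEval_sub, evalEval_mul, evalEval_finsetSum, evalEval_C, eval_C,
      evalEval_map_C, conj_eval]
  have hPO : (fun s => P.evalEval (conj s) s) =O[𝓝 0] fun s => ‖s‖ ^ N := by
    have h1 : (fun s => (∑ j, ∑ k, A j k * (F j s * conj (F k s - (T k).eval s) +
        (F j s - (T j).eval s) * conj ((T k).eval s)))) =O[𝓝 0] fun s : ℂ => ‖s‖ ^ N := by
      refine Asymptotics.IsBigO.fun_sum fun j _ => ?_
      refine Asymptotics.IsBigO.fun_sum fun k _ => ?_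
      refine Asymptotics.IsBigO.const_mul_left (Asymptotics.IsBigO.add ?_ ?_) _
      · have h3 : F j =O[𝓝 0] fun _ => (1 : ℝ) := (hF j).tendsto.isBigO_one ℝ
        simpa using h3.mul (hconj (hT k))
      · have : ContinuousAt (fun s => conj ((T k).eval s)) 0 := by fun_prop
        have h3 : (fun s => conj ((T k).eval s)) =O[𝓝 0] fun _ => (1 : ℝ) :=
          this.tendsto.isBigO_one ℝ
        simpa using (hT j).mul h3
    have h2 : (fun s => 1 / (2 * Complex.I) * ((G s - S.eval s) - conj (G s - S.eval s))) =O[𝓝 0]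
        fun s : ℂ => ‖s‖ ^ N := (hS.sub (hconj hS)).const_mul_left _
    have h3 := (hQ.sub h1).add h2
    refine h3.congr_left fun s => ?_
    rw [hPeval, him, him]
    have : (∑ j, ∑ k, A j k * (F j s * conj (F k s - (T k).eval s) +
        (F j s - (T j).eval s) * conj ((T k).eval s))) =
        (∑ j, ∑ k, A j k * F j s * conj (F k s)) -
          ∑ j, ∑ k, A j k * (T j).eval s * conj ((T k).eval s) := by
      simp only [← Finset.sum_sub_distrib]
      refine Finset.sum_congr rfl fun j _ => Finset.sum_congr rfl fun k _ => ?_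
      rw [map_sub]
      ring
    rw [this, map_sub]
    ring
  have := Polynomial.coeff_coeff_eq_zero_of_isBigO hPO hab
  have hb0 : b ≠ 0 := by omega
  have ha0 : a ≠ 0 := by omega
  simp only [hP, coeff_sub, finsetSum_coeff, mul_assoc, coeff_C_mul, coeff_mul_C, coeff_map,
    coeff_C, if_neg hb0, if_neg ha0, sub_zero, sub_eq_zero] at this
  simpa [mul_assoc] using this

/-! ### Coefficients of the model polynomial and linear independence -/

section
open Polynomial

theorem Polynomial.coeff_C_add_pow {R : Type*} [CommRing R] (u : R) {T : R[X]} {m k a : ℕ}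
    (hT : X ^ m ∣ T) (hk : 2 ≤ k) (ha : 1 ≤ a) (ham : a < 3 * m) :
    ((C u + T) ^ k).coeff a =
      k * u ^ (k - 1) * T.coeff a + (k.choose 2) * u ^ (k - 2) * (T ^ 2).coeff a := by
  have hterm : ∀ j, (T ^ j * C u ^ (k - j) * ((k.choose j : ℕ) : R[X])).coeff a =
      (T ^ j).coeff a * u ^ (k - j) * (k.choose j : ℕ) := by
    intro j
    rw [← C_eq_natCast, ← C_pow, coeff_mul_C, coeff_mul_C]
  rw [add_comm, add_pow, finsetSum_coeff]
  simp only [hterm]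
  rw [← Finset.sum_subset (s₁ := {0, 1, 2})]
  · rw [Finset.sum_insert (by simp), Finset.sum_pair (by simp)]
    have : (1 : R[X]).coeff a = 0 := by rw [coeff_one, if_neg (by omega)]
    simp only [pow_zero, this, pow_one, Nat.choose_one_right]
    ring
  · intro x hx
    simp only [Finset.mem_insert, Finset.mem_singleton] at hx
    rw [Finset.mem_range]
    omega
  · intro j _ hj
    simp only [Finset.mem_insert, Finset.mem_singleton, not_or] at hj
    have h1 : X ^ (m * j) ∣ T ^ j := by rw [pow_mul]; exact pow_dvd_pow_of_dvd hT j
    have h2 : (T ^ j).coeff a = 0 :=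
      X_pow_dvd_iff.1 h1 a (by nlinarith [show 3 ≤ j by omega])
    rw [h2]
    simp

variable {r : ℕ}

/-- The polynomial `c (s ^ D + conj s ^ D + ∑ i, ℓ i |s| ^ (2 d i)) ^ k` with `D = 2 m` and
`d i = m + e i`, written in the outer variable `s` and the inner variable `conj s`: the leading
part of a `k`-th power of a defining function along a curve of weights `d i` in the
directions diagonalizing the Levi form and `D` in the transverse direction. -/
noncomputable def modelPolynomial (c : ℂ) (ℓ : Fin r → ℂ) (e : Fin r → ℕ) (m k : ℕ) : ℂ[X][X] :=
  C (C c) * (C (X ^ (2 * m)) +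
    (∑ i, C (C (ℓ i) * X ^ (m + e i)) * X ^ (m + e i) + X ^ (2 * m))) ^ k

theorem coeff_modelPolynomial (c : ℂ) (ℓ : Fin r → ℂ) (e : Fin r → ℕ) {m k a : ℕ} (hk : 2 ≤ k)
    (ha : 1 ≤ a) (ham : a < 3 * m) :
    (modelPolynomial c ℓ e m k).coeff a =
      C c * ((k : ℂ[X]) * X ^ (2 * m * (k - 1)) * ((∑ i, if a = m + e i then C (ℓ i) * X ^ (m + e i) else 0) +
          if a = 2 * m then 1 else 0) +
        ((k.choose 2 : ℕ) : ℂ[X]) * X ^ (2 * m * (k - 2)) * ∑ i, ∑ j, if a = 2 * m + e i + e j then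
          C (ℓ i * ℓ j) * X ^ (2 * m + e i + e j) else 0) := by
  set S : ℂ[X][X] := ∑ i, C (C (ℓ i) * X ^ (m + e i)) * X ^ (m + e i) with hS
  have hSd : X ^ m ∣ S := Finset.dvd_sum fun i _ =>
    (pow_dvd_pow X (Nat.le_add_right m (e i))).mul_left _
  have hXd : (X : ℂ[X][X]) ^ m ∣ X ^ (2 * m) := pow_dvd_pow _ (by omega)
  have hScoeff : S.coeff a = ∑ i, if a = m + e i then C (ℓ i) * X ^ (m + e i) else 0 := by
    rw [hS, finsetSum_coeff]
    simp only [coeff_C_mul_X_pow]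
  have hsq : ((S + X ^ (2 * m)) ^ 2).coeff a = ∑ i, ∑ j, if a = 2 * m + e i + e j then
      C (ℓ i * ℓ j) * X ^ (2 * m + e i + e j) else 0 := by
    have h1 : (S + X ^ (2 * m)) ^ 2 = S * S + X ^ (2 * m) * (2 * S + X ^ (2 * m)) := by ring
    have h2 : X ^ (3 * m) ∣ X ^ (2 * m) * (2 * S + X ^ (2 * m)) := by
      rw [show 3 * m = 2 * m + m by ring, pow_add]
      exact mul_dvd_mul_left _ (dvd_add (hSd.mul_left _) hXd)
    rw [h1, coeff_add, X_pow_dvd_iff.1 h2 a ham, add_zero, hS, Finset.sum_mul_sum,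
      finsetSum_coeff]
    refine Finset.sum_congr rfl fun i _ => ?_
    rw [finsetSum_coeff]
    refine Finset.sum_congr rfl fun j _ => ?_
    have h3 : (C (C (ℓ i) * X ^ (m + e i)) * X ^ (m + e i) * (C (C (ℓ j) * X ^ (m + e j)) *
        X ^ (m + e j)) : ℂ[X][X]) = C (C (ℓ i * ℓ j) * X ^ (2 * m + e i + e j)) *
          X ^ (2 * m + e i + e j) := by
      rw [show 2 * m + e i + e j = (m + e i) + (m + e j) by ring, pow_add, pow_add]
      simp only [map_mul, map_pow]
      ring
    rw [h3, coeff_C_mul_X_pow]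
  rw [modelPolynomial, coeff_C_mul, coeff_C_add_pow _ (dvd_add hSd hXd) hk ha ham, coeff_add,
    hScoeff, hsq, coeff_X_pow, ← pow_mul, ← pow_mul]

variable {c : ℂ} {ℓ : Fin r → ℂ} {e : Fin r → ℕ} {m k : ℕ}

theorem coeff_modelPolynomial_add (hk : 2 ≤ k) (he : Function.Injective e)
    (hm : ∀ i, 4 * e i < m) (i : Fin r) (b : ℕ) :
    ((modelPolynomial c ℓ e m k).coeff (m + e i)).coeff b =
      if b = 2 * m * (k - 1) + (m + e i) then c * k * ℓ i else 0 := by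
  have := hm i
  rw [coeff_modelPolynomial c ℓ e hk (by omega) (by omega), if_neg (by omega),
    Finset.sum_eq_single i, if_pos rfl]
  · have h0 : (∑ i', ∑ j', if m + e i = 2 * m + e i' + e j' then
        C (ℓ i' * ℓ j') * X ^ (2 * m + e i' + e j') else 0 : ℂ[X]) = 0 :=
      Finset.sum_eq_zero fun i' _ => Finset.sum_eq_zero fun j' _ => if_neg (by omega)
    rw [h0, mul_zero, add_zero, add_zero]
    have : (C c * ((k : ℂ[X]) * X ^ (2 * m * (k - 1)) * (C (ℓ i) * X ^ (m + e i))) : ℂ[X]) =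
        C (c * k * ℓ i) * X ^ (2 * m * (k - 1) + (m + e i)) := by
      rw [pow_add]
      simp only [map_mul, map_natCast]
      ring
    rw [this, coeff_C_mul_X_pow]
  · intro j _ hj
    rw [if_neg]
    intro h
    exact hj (he (by omega))
  · simp

theorem coeff_modelPolynomial_two_mul (hk : 2 ≤ k) (he : ∀ i, 1 ≤ e i) (hm0 : 0 < m)
    (hm : ∀ i, 4 * e i < m) (b : ℕ) :
    ((modelPolynomial c ℓ e m k).coeff (2 * m)).coeff b =
      if b = 2 * m * (k - 1) then c * k else 0 := by
  rw [coeff_modelPolynomial c ℓ e hk (by omega) (by omega), if_pos rfl]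
  have h0 : (∑ i, ∑ j, if 2 * m = 2 * m + e i + e j then
      C (ℓ i * ℓ j) * X ^ (2 * m + e i + e j) else 0 : ℂ[X]) = 0 :=
    Finset.sum_eq_zero fun i _ => Finset.sum_eq_zero fun j _ => if_neg (by have := he i; omega)
  have h1 : (∑ i, if 2 * m = m + e i then C (ℓ i) * X ^ (m + e i) else 0 : ℂ[X]) = 0 :=
    Finset.sum_eq_zero fun i _ => if_neg (by have := hm i; omega)
  rw [h0, h1, mul_zero, add_zero, zero_add, mul_one]
  have : (C c * ((k : ℂ[X]) * X ^ (2 * m * (k - 1))) : ℂ[X]) = C (c * k) * X ^ (2 * m * (k - 1)) := by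
    simp only [map_mul, map_natCast]
    ring
  rw [this, coeff_C_mul_X_pow]

theorem coeff_modelPolynomial_two_mul_add (hk : 2 ≤ k) (he : ∀ i, 1 ≤ e i)
    (hsidon : ∀ i j l, e i + e j = 2 * e l → i = l ∧ j = l)
    (hm : ∀ i, 4 * e i < m) (i : Fin r) (b : ℕ) :
    ((modelPolynomial c ℓ e m k).coeff (2 * m + 2 * e i)).coeff b =
      if b = 2 * m * (k - 2) + (2 * m + 2 * e i) then c * (k.choose 2) * ℓ i ^ 2 else 0 := by
  have hi := hm i
  have hi' := he i
  rw [coeff_modelPolynomial c ℓ e hk (by omega) (by omega), if_neg (by omega)]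
  have h1 : (∑ j, if 2 * m + 2 * e i = m + e j then C (ℓ j) * X ^ (m + e j) else 0 : ℂ[X]) = 0 :=
    Finset.sum_eq_zero fun j _ => if_neg (by have := hm j; omega)
  have h0 : (∑ j, ∑ l, if 2 * m + 2 * e i = 2 * m + e j + e l then
      C (ℓ j * ℓ l) * X ^ (2 * m + e j + e l) else 0 : ℂ[X]) =
      C (ℓ i * ℓ i) * X ^ (2 * m + e i + e i) := by
    rw [Finset.sum_eq_single i, Finset.sum_eq_single i, if_pos (by omega)]
    · intro l _ hl
      rw [if_neg]
      exact fun h => hl (hsidon i l i (by omega)).2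
    · simp
    · intro j _ hj
      refine Finset.sum_eq_zero fun l _ => ?_
      rw [if_neg]
      exact fun h => hj (hsidon j l i (by omega)).1
    · simp
  rw [h0, h1, add_zero, mul_zero, zero_add]
  have : (C c * (((k.choose 2 : ℕ) : ℂ[X]) * X ^ (2 * m * (k - 2)) *
      (C (ℓ i * ℓ i) * X ^ (2 * m + e i + e i))) : ℂ[X]) =
      C (c * (k.choose 2 : ℕ) * ℓ i ^ 2) * X ^ (2 * m * (k - 2) + (2 * m + 2 * e i)) := by
    rw [show 2 * m * (k - 2) + (2 * m + 2 * e i) = 2 * m * (k - 2) + (2 * m + e i + e i) by ring,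
      pow_add _ (2 * m * (k - 2))]
    simp only [map_mul, map_natCast, map_pow]
    ring
  rw [this, coeff_C_mul_X_pow]

/-- If vectors `f a` of a hermitian space have the mixed coefficients of the model polynomial as
their pairings in low total degree, then the `3 r + 1` vectors of index `m + e i`, `2 m`,
`2 m + 2 e i` and `2 m (k - 1) + (m + e i)` are linearly independent, their Gram matrix being
triangular for a suitable order of rows and columns. -/
theorem three_mul_add_one_le_card {ι : Type*} [Fintype ι] {A : Matrix ι ι ℂ} (hA : A.IsHermitian)
    (hc : c ≠ 0) (hℓ : ∀ i, ℓ i ≠ 0) (hk : 2 ≤ k) (he : ∀ i, 1 ≤ e i)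
    (hsidon : ∀ i j l, e i + e j = 2 * e l → i = l ∧ j = l) (hm0 : 0 < m)
    (hm : ∀ i, 4 * e i < m) {f : ℕ → ι → ℂ}
    (hf : ∀ a b, 1 ≤ a → 1 ≤ b → a + b < m * (2 * k + 1) →
      ∑ x, ∑ y, A x y * f a x * conj (f b y) = ((modelPolynomial c ℓ e m k).coeff a).coeff b) :
    3 * r + 1 ≤ Fintype.card ι := by
  have hinj : Function.Injective e := fun i j hij => (hsidon i i j (by omega)).1
  obtain ⟨k, rfl⟩ : ∃ k', k = k' + 2 := ⟨k - 2, by omega⟩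
  set B : (ι → ℂ) → (ι → ℂ) → ℂ := fun x y => x ⬝ᵥ (A.mulVec (star y)) with hB
  have hBf : ∀ a b, 1 ≤ a → 1 ≤ b → a + b < m * (2 * (k + 2) + 1) →
      B (f a) (f b) = ((modelPolynomial c ℓ e m (k + 2)).coeff a).coeff b := by
    intro a b ha hb hab
    rw [← hf a b ha hb hab]
    simp only [hB, dotProduct, Matrix.mulVec, Finset.mul_sum, Pi.star_apply, RCLike.star_def]
    exact Finset.sum_congr rfl fun _ _ => Finset.sum_congr rfl fun _ _ => by ring
  have hBsymm : ∀ x y, B y x = conj (B x y) := by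
    intro x y
    simp only [hB, dotProduct, Matrix.mulVec, map_sum, map_mul, Pi.star_apply, RCLike.star_def,
      Complex.conj_conj, Finset.mul_sum]
    rw [Finset.sum_comm]
    refine Finset.sum_congr rfl fun i _ => Finset.sum_congr rfl fun j _ => ?_
    rw [← hA.apply j i, RCLike.star_def]
    ring
  have hk2 : 2 ≤ k + 2 := by omega
  have hexp : m * (2 * (k + 2) + 1) = 2 * (m * k) + 5 * m := by ring
  have hexp1 : 2 * m * (k + 1) = 2 * (m * k) + 2 * m := by ring
  have hexp2 : 2 * m * k = 2 * (m * k) := by ring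
  have row1 : ∀ i b, 1 ≤ b → (m + e i) + b < m * (2 * (k + 2) + 1) → B (f (m + e i)) (f b) =
      if b = 2 * m * (k + 1) + (m + e i) then c * (k + 2 : ℕ) * ℓ i else 0 := fun i b hb hlt => by
    rw [hBf _ _ (by omega) hb hlt, coeff_modelPolynomial_add hk2 hinj hm]
    rfl
  have row2 : ∀ b, 1 ≤ b → 2 * m + b < m * (2 * (k + 2) + 1) → B (f (2 * m)) (f b) =
      if b = 2 * m * (k + 1) then c * (k + 2 : ℕ) else 0 := fun b hb hlt => by
    rw [hBf _ _ (by omega) hb hlt, coeff_modelPolynomial_two_mul hk2 he hm0 hm]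
    rfl
  have row3 : ∀ i b, 1 ≤ b → (2 * m + 2 * e i) + b < m * (2 * (k + 2) + 1) →
      B (f (2 * m + 2 * e i)) (f b) = if b = 2 * m * k + (2 * m + 2 * e i) then
        c * ((k + 2).choose 2 : ℕ) * ℓ i ^ 2 else 0 := fun i b hb hlt => by
    rw [hBf _ _ (by omega) hb hlt, coeff_modelPolynomial_two_mul_add hk2 he hsidon hm]
    rfl
  have row4 : ∀ i j, B (f (2 * m * (k + 1) + (m + e i))) (f (m + e j)) =
      if i = j then conj (c * (k + 2 : ℕ) * ℓ j) else 0 := fun i j => by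
    have := hm i
    have := hm j
    rw [hBsymm, row1 j _ (by omega) (by omega)]
    split_ifs with h1 h2 h2
    · rfl
    · exact absurd (hinj (by omega)) h2
    · exact absurd (by rw [h2]) h1
    · simp
  have hck : c * ((k + 2 : ℕ) : ℂ) ≠ 0 := mul_ne_zero hc (by norm_cast)
  have hck' : c * (((k + 2).choose 2 : ℕ) : ℂ) ≠ 0 :=
    mul_ne_zero hc (by exact_mod_cast (Nat.choose_pos hk2).ne')
  set w : (Fin r ⊕ Unit) ⊕ (Fin r ⊕ Fin r) → ι → ℂ :=
    Sum.elim (Sum.elim (fun i => f (m + e i)) fun _ => f (2 * m))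
      (Sum.elim (fun i => f (2 * m + 2 * e i)) fun i => f (2 * m * (k + 1) + (m + e i))) with hw
  have hli : LinearIndependent ℂ w := by
    rw [Fintype.linearIndependent_iff]
    intro g hg
    have hpair : ∀ y, (∑ i, g (.inl (.inl i)) * B (f (m + e i)) y) +
        g (.inl (.inr ())) * B (f (2 * m)) y +
        ((∑ i, g (.inr (.inl i)) * B (f (2 * m + 2 * e i)) y) +
          ∑ i, g (.inr (.inr i)) * B (f (2 * m * (k + 1) + (m + e i))) y) = 0 := by
      intro y
      have h1 := congrArg (fun x => B x y) hg
      simp only [hB, sum_dotProduct, smul_dotProduct, smul_eq_mul, zero_dotProduct] at h1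
      simpa only [Fintype.sum_sum_type, Finset.univ_unique, Finset.sum_singleton, hw,
        Sum.elim_inl, Sum.elim_inr, hB] using h1
    have h4 : ∀ j, g (.inr (.inr j)) = 0 := by
      intro j
      have hj := hm j
      have := hpair (f (m + e j))
      have z1 : ∀ i, B (f (m + e i)) (f (m + e j)) = 0 := fun i => by
        have := hm i
        rw [row1 i _ (by omega) (by omega), if_neg (by omega)]
      have z2 : B (f (2 * m)) (f (m + e j)) = 0 := by
        rw [row2 _ (by omega) (by omega), if_neg (by omega)]
      have z3 : ∀ i, B (f (2 * m + 2 * e i)) (f (m + e j)) = 0 := fun i => by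
        have := hm i
        rw [row3 i _ (by omega) (by omega), if_neg (by omega)]
      simp only [z1, z2, z3, row4, mul_zero, Finset.sum_const_zero, zero_add, mul_ite,
        Finset.sum_ite_eq', Finset.mem_univ, if_true] at this
      exact (mul_eq_zero.1 this).resolve_right
        ((_root_.map_ne_zero _).2 (mul_ne_zero hck (hℓ j)))
    have h2 : g (.inl (.inr ())) = 0 := by
      have := hpair (f (2 * m * (k + 1)))
      have z1 : ∀ i, B (f (m + e i)) (f (2 * m * (k + 1))) = 0 := fun i => by
        have := hm i
        rw [row1 i _ (by omega) (by omega), if_neg (by omega)]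
      have z3 : ∀ i, B (f (2 * m + 2 * e i)) (f (2 * m * (k + 1))) = 0 := fun i => by
        have := hm i
        have := he i
        rw [row3 i _ (by omega) (by omega), if_neg (by omega)]
      rw [row2 _ (by omega) (by omega), if_pos rfl] at this
      simp only [z1, z3, h4, mul_zero, zero_mul, Finset.sum_const_zero, zero_add, add_zero] at this
      exact (mul_eq_zero.1 this).resolve_right hck
    have h3 : ∀ j, g (.inr (.inl j)) = 0 := by
      intro j
      have hj := hm j
      have := hpair (f (2 * m * k + (2 * m + 2 * e j)))
      have z1 : ∀ i, B (f (m + e i)) (f (2 * m * k + (2 * m + 2 * e j))) = 0 := fun i => by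
        have := hm i
        rw [row1 i _ (by omega) (by omega), if_neg (by omega)]
      have z3 : ∀ i, B (f (2 * m + 2 * e i)) (f (2 * m * k + (2 * m + 2 * e j))) =
          if i = j then c * ((k + 2).choose 2 : ℕ) * ℓ j ^ 2 else 0 := fun i => by
        have := hm i
        rw [row3 i _ (by omega) (by omega)]
        split_ifs with h1 h2 h2
        · rw [h2]
        · exact absurd (hinj (by omega)) h2
        · exact absurd (by rw [h2]) h1
        · rfl
      simp only [z1, z3, h4, h2, mul_zero, zero_mul, Finset.sum_const_zero, zero_add, add_zero,
        mul_ite, Finset.sum_ite_eq', Finset.mem_univ, if_true] at this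
      exact (mul_eq_zero.1 this).resolve_right (mul_ne_zero hck' (pow_ne_zero _ (hℓ j)))
    have h1 : ∀ j, g (.inl (.inl j)) = 0 := by
      intro j
      have hj := hm j
      have := hpair (f (2 * m * (k + 1) + (m + e j)))
      have z1 : ∀ i, B (f (m + e i)) (f (2 * m * (k + 1) + (m + e j))) =
          if i = j then c * (k + 2 : ℕ) * ℓ j else 0 := fun i => by
        have := hm i
        rw [row1 i _ (by omega) (by omega)]
        split_ifs with h1 h2 h2
        · rw [h2]
        · exact absurd (hinj (by omega)) h2
        · exact absurd (by rw [h2]) h1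
        · rfl
      simp only [z1, h4, h2, h3, zero_mul, Finset.sum_const_zero, add_zero, mul_zero,
        mul_ite, Finset.sum_ite_eq', Finset.mem_univ, if_true] at this
      exact (mul_eq_zero.1 this).resolve_right (mul_ne_zero hck (hℓ j))
    rintro ((i | i) | (i | i))
    exacts [h1 i, h2, h3 i, h4 i]
  have hcard := hli.fintype_card_le_finrank
  simp only [Fintype.card_sum, Fintype.card_fin, Fintype.card_unit, Module.finrank_fintype_fun_eq_card]
    at hcard
  omega

end

/-! ### Order of vanishing along a hypersurface -/

section
variable {E : Type*} [NormedAddCommGroup E] [NormedSpace ℝ E]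

theorem Asymptotics.IsBigO.pow_sub_pow {α : Type*} {l : Filter α} {f g a b : α → ℝ}
    (hfg : (fun x => f x - g x) =O[l] a) (hf : f =O[l] b) (hg : g =O[l] b) (k : ℕ) :
    (fun x => f x ^ k - g x ^ k) =O[l] fun x => a x * b x ^ (k - 1) := by
  have hsum : (fun x => ∑ i ∈ Finset.range k, f x ^ i * g x ^ (k - 1 - i)) =O[l]
      fun x => b x ^ (k - 1) := by
    refine Asymptotics.IsBigO.fun_sum fun i hi => ?_
    have hi' : i < k := Finset.mem_range.1 hi
    refine ((hf.pow i).mul (hg.pow (k - 1 - i))).congr_right fun x => ?_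
    rw [← pow_add]
    congr 1
    omega
  refine (hfg.mul hsum).congr_left fun x => ?_
  rw [mul_comm]
  exact (Commute.all _ _).geom_sum₂_mul k

/-- The `n`-th derivative of `u` in the direction `e`. -/
noncomputable def iteratedDirDeriv (e : E) (n : ℕ) (u : E → ℝ) : E → ℝ :=
  (fun (v : E → ℝ) q => fderiv ℝ v q e)^[n] u

theorem iteratedDirDeriv_succ (e : E) (n : ℕ) (u : E → ℝ) :
    iteratedDirDeriv e (n + 1) u = fun q => fderiv ℝ (iteratedDirDeriv e n u) q e :=
  Function.iterate_succ_apply' _ n u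

theorem analyticAt_iteratedDirDeriv {u : E → ℝ} {p : E} (hu : AnalyticAt ℝ u p) (e : E) (n : ℕ) :
    AnalyticAt ℝ (iteratedDirDeriv e n u) p := by
  induction n with
  | zero => exact hu
  | succ n ih =>
    rw [iteratedDirDeriv_succ]
    exact ((ContinuousLinearMap.apply ℝ ℝ e).analyticAt _).comp ih.fderiv

theorem AnalyticAt.comp_line {u : E → ℝ} {m e : E} {t : ℝ} (hu : AnalyticAt ℝ u (m + t • e)) :
    AnalyticAt ℝ (fun t : ℝ => u (m + t • e)) t :=
  AnalyticAt.comp (g := u) (f := fun t : ℝ => m + t • e) hu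
    (analyticAt_const.add (analyticAt_id.smul analyticAt_const))

theorem iteratedDeriv_comp_line_eq_iteratedDirDeriv {u : E → ℝ} {W : Set E} (hW : IsOpen W)
    (hu : AnalyticOnNhd ℝ u W) (m e : E) (n : ℕ) :
    ∀ t : ℝ, m + t • e ∈ W →
      iteratedDeriv n (fun t : ℝ => u (m + t • e)) t = iteratedDirDeriv e n u (m + t • e) := by
  induction n with
  | zero => intro t _; simp [iteratedDirDeriv]
  | succ n ih =>
    intro t ht
    have hopen : IsOpen ((fun t : ℝ => m + t • e) ⁻¹' W) := hW.preimage (by fun_prop)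
    have he : iteratedDeriv n (fun t : ℝ => u (m + t • e)) =ᶠ[𝓝 t]
        fun t => iteratedDirDeriv e n u (m + t • e) := by
      filter_upwards [hopen.mem_nhds ht] with s hs using ih s hs
    rw [iteratedDeriv_succ, he.deriv_eq, iteratedDirDeriv_succ]
    have hline : HasDerivAt (fun t : ℝ => m + t • e) e t := by
      simpa using ((hasDerivAt_id t).smul_const e).const_add m
    exact ((analyticAt_iteratedDirDeriv (hu _ ht) e n).differentiableAt.hasFDerivAt.comp_hasDerivAt t
      hline).deriv

theorem abs_sub_le_of_iteratedDeriv_eq_zero {g : ℝ → ℝ} {k : ℕ} {τ A ε : ℝ} (hk : 1 ≤ k)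
    (hg : ∀ t ∈ Set.uIcc 0 τ, AnalyticAt ℝ g t) (h0 : ∀ j < k, iteratedDeriv j g 0 = 0)
    (hA : ∀ t ∈ Set.uIcc 0 τ, |iteratedDeriv k g t - A| ≤ ε) :
    |g τ - A * τ ^ k / k.factorial| ≤ ε * |τ| ^ k := by
  obtain ⟨n, rfl⟩ : ∃ n, k = n + 1 := ⟨k - 1, by omega⟩
  rcases eq_or_ne τ 0 with rfl | hτ
  · have := h0 0 (by omega)
    simp only [iteratedDeriv_zero] at this
    simp [this]
  obtain ⟨x, hx, hgx⟩ := taylor_mean_remainder_lagrange_iteratedDeriv (n := n) hτ.symm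
    (fun t ht => (hg t ht).contDiffAt.contDiffWithinAt : ContDiffOn ℝ (n + 1) g (Set.uIcc 0 τ))
  have hT : taylorWithinEval g n (Set.uIcc 0 τ) 0 τ = 0 := by
    rw [taylor_within_apply]
    refine Finset.sum_eq_zero fun j hj => ?_
    rw [iteratedDerivWithin_eq_iteratedDeriv (uniqueDiffOn_uIcc hτ.symm)
      (hg 0 Set.left_mem_uIcc).contDiffAt Set.left_mem_uIcc, h0 j (by simpa using hj), smul_zero]
  have hx' := hA x (Set.uIoo_subset_uIcc_self hx)
  rw [hT, sub_zero, sub_zero] at hgx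
  have hfac : (1 : ℝ) ≤ (n + 1).factorial := by exact_mod_cast Nat.factorial_pos (n + 1)
  have hε : 0 ≤ ε := (abs_nonneg _).trans hx'
  rw [hgx, ← sub_div, ← sub_mul, abs_div, abs_mul, abs_pow, Nat.abs_cast]
  refine (div_le_self (by positivity) hfac).trans ?_
  gcongr

/-- Taylor's formula along lines of direction `e`, at a point `m` where the first `k` derivatives
vanish, uniformly for `m` near `p`. -/
theorem AnalyticAt.exists_abs_sub_iteratedDirDeriv_le {u : E → ℝ} {p : E} (hu : AnalyticAt ℝ u p)
    (e : E) {k : ℕ} (hk : 1 ≤ k) :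
    ∃ C > 0, ∃ δ > 0, ∀ m : E, ∀ τ : ℝ, ‖m - p‖ < δ → ‖m + τ • e - p‖ < δ →
      (∀ j < k, iteratedDirDeriv e j u m = 0) →
      |u (m + τ • e) - iteratedDirDeriv e k u p * τ ^ k / k.factorial| ≤
        C * (‖m - p‖ + ‖m + τ • e - p‖) * |τ| ^ k := by
  obtain ⟨C, hC, hL⟩ := ((analyticAt_iteratedDirDeriv hu e k).differentiableAt.hasFDerivAt.isBigO_sub).exists_pos
  obtain ⟨δ, hδ, hball⟩ := Metric.eventually_nhds_iff_ball.1
    (hu.eventually_analyticAt.and hL.bound)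
  refine ⟨C, hC, δ, hδ, fun m τ hm hmτ h0 => ?_⟩
  set s := max ‖m - p‖ ‖m + τ • e - p‖ with hs
  have hseg : ∀ t ∈ Set.uIcc 0 τ, ‖m + t • e - p‖ ≤ s := by
    intro t ht
    have hconv : Convex ℝ {t : ℝ | ‖m + t • e - p‖ ≤ s} := by
      have : {t : ℝ | ‖m + t • e - p‖ ≤ s} =
          (AffineMap.lineMap m (m + e) : ℝ →ᵃ[ℝ] E) ⁻¹' Metric.closedBall p s := by
        ext t
        simp [AffineMap.lineMap_apply, dist_eq_norm, add_comm]
      rw [this]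
      exact (convex_closedBall p s).affine_preimage _
    rw [← segment_eq_uIcc] at ht
    exact hconv.segment_subset (x := 0) (y := τ) (by simp [hs]) (by simp [hs]) ht
  have hmem : ∀ t ∈ Set.uIcc 0 τ, m + t • e ∈ Metric.ball p δ := fun t ht => by
    rw [mem_ball_iff_norm]
    exact (hseg t ht).trans_lt (max_lt hm hmτ)
  have han : AnalyticOnNhd ℝ u (Metric.ball p δ) := fun q hq => (hball q hq).1
  have key := abs_sub_le_of_iteratedDeriv_eq_zero (g := fun t : ℝ => u (m + t • e)) (τ := τ)
    (A := iteratedDirDeriv e k u p) (ε := C * s) hk (fun t ht => (han _ (hmem t ht)).comp_line)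
    (fun j hj => by
      rw [iteratedDeriv_comp_line_eq_iteratedDirDeriv Metric.isOpen_ball han m e j 0
        (hmem 0 Set.left_mem_uIcc)]
      simpa using h0 j hj)
    (fun t ht => by
      rw [iteratedDeriv_comp_line_eq_iteratedDirDeriv Metric.isOpen_ball han m e k t (hmem t ht)]
      refine ((hball _ (hmem t ht)).2).trans ?_
      gcongr
      exact hseg t ht)
  refine key.trans ?_
  gcongr
  exact max_le_add_of_nonneg (norm_nonneg _) (norm_nonneg _)

/-- Near a point where the derivative of `ρ` in the direction `e` does not vanish, the zero set of
`ρ` can be reached along `e`, in time comparable with `ρ`. -/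
theorem HasStrictFDerivAt.exists_eventually_zero_along {ρ : E → ℝ} {ρ' : E →L[ℝ] ℝ} {p e : E}
    (hρ : HasStrictFDerivAt ρ ρ' p) (hρ0 : ρ p = 0) (he : ρ' e ≠ 0) :
    ∃ C > 0, ∀ᶠ q in 𝓝 p, ∃ τ : ℝ, |τ| ≤ C * |ρ q| ∧ ρ (q - τ • e) = 0 := by
  set b := ρ' e with hb
  have he0 : e ≠ 0 := fun h => he (by simp [hb, h])
  have hen : 0 < ‖e‖ := norm_pos_iff.2 he0
  have hbpos : 0 < |b| := abs_pos.2 he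
  have hstrict := hρ.isLittleO.def (c := |b| / (2 * ‖e‖)) (by positivity)
  have hcont : ∀ᶠ q in 𝓝 p, ContinuousAt ρ q := by
    obtain ⟨K, s, hs, hK⟩ := hρ.exists_lipschitzOnWith
    filter_upwards [eventually_mem_nhds_iff.2 hs] with q hq
    exact hK.continuousOn.continuousAt hq
  obtain ⟨δ, hδ, hball⟩ := Metric.eventually_nhds_iff_ball.1
    ((hcont.prodMk_nhds hcont).and hstrict)
  have hsmall : ∀ᶠ q in 𝓝 p, ‖q - p‖ + 2 * |ρ q| / |b| * ‖e‖ < δ := by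
    have h1 : ContinuousAt (fun q => ‖q - p‖ + 2 * |ρ q| / |b| * ‖e‖) p := by
      have := hρ.continuousAt
      fun_prop
    refine h1.eventually_lt continuousAt_const ?_
    simpa [hρ0] using hδ
  refine ⟨2 / |b|, by positivity, ?_⟩
  filter_upwards [hsmall] with q hq
  set T := 2 * |ρ q| / |b| with hT
  have hT0 : 0 ≤ T := by positivity
  have hmem : ∀ t ∈ Set.Icc (-T) T, ‖q - t • e - p‖ < δ := by
    intro t ht
    calc ‖q - t • e - p‖ = ‖(q - p) - t • e‖ := by congr 1; abel
      _ ≤ ‖q - p‖ + ‖t • e‖ := norm_sub_le _ _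
      _ ≤ ‖q - p‖ + T * ‖e‖ := by
          rw [norm_smul]
          gcongr
          exact abs_le.2 ht
      _ < δ := hq
  have hqmem : ‖q - p‖ < δ := by
    have := mul_nonneg hT0 hen.le
    linarith
  have hpair : ∀ t ∈ Set.Icc (-T) T, (q - t • e, q) ∈ Metric.ball (p, p) δ := by
    intro t ht
    rw [← ball_prod_same]
    exact ⟨by simpa [dist_eq_norm] using hmem t ht, by simpa [dist_eq_norm] using hqmem⟩
  have hest : ∀ t ∈ Set.Icc (-T) T, |ρ (q - t • e) - ρ q + b * t| ≤ |b| / 2 * |t| := by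
    intro t ht
    have := (hball _ (hpair t ht)).2
    simp only [sub_sub_cancel_left, map_neg, map_smul, smul_eq_mul, ← hb, norm_neg, norm_smul,
      Real.norm_eq_abs] at this
    calc |ρ (q - t • e) - ρ q + b * t| = |ρ (q - t • e) - ρ q - -(t * b)| := by congr 1; ring
      _ ≤ |b| / (2 * ‖e‖) * (|t| * ‖e‖) := this
      _ = |b| / 2 * |t| := by field_simp
  have hg : ContinuousOn (fun t : ℝ => b * ρ (q - t • e)) (Set.Icc (-T) T) := by
    intro t ht
    have h1 := (hball _ (hpair t ht)).1.1
    have h2 : ContinuousAt (fun t : ℝ => ρ (q - t • e)) t :=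
      ContinuousAt.comp (g := ρ) (f := fun t : ℝ => q - t • e) h1 (by fun_prop)
    exact (continuousAt_const.mul h2).continuousWithinAt
  have hbT : |b| * T = 2 * |ρ q| := by
    rw [hT]; field_simp
  have hbb : b * b = |b| * |b| := (abs_mul_abs_self b).symm
  have hbρ := abs_le.1 (abs_mul b (ρ q)).le
  have hend : ∀ t ∈ Set.Icc (-T) T, |b * ρ (q - t • e) - b * ρ q + b * b * t| ≤
      |b| * (|b| / 2 * |t|) := by
    intro t ht
    calc _ = |b * (ρ (q - t • e) - ρ q + b * t)| := by congr 1; ring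
      _ = |b| * |ρ (q - t • e) - ρ q + b * t| := abs_mul _ _
      _ ≤ _ := by gcongr; exact hest t ht
  have h1 := abs_le.1 (hend T ⟨by linarith, le_rfl⟩)
  have h2 := abs_le.1 (hend (-T) ⟨le_rfl, by linarith⟩)
  rw [abs_of_nonneg hT0] at h1
  rw [abs_neg, abs_of_nonneg hT0] at h2
  have hbbT : |b| * |b| * T = 2 * (|b| * |ρ q|) := by rw [mul_assoc, hbT]; ring
  have hx : |b| * (|b| / 2 * T) = |b| * |ρ q| := by linarith
  have hy : b * b * T = 2 * (|b| * |ρ q|) := by rw [hbb, hbbT]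
  rw [hx] at h1 h2
  obtain ⟨t, ht, hzero⟩ : (0 : ℝ) ∈ (fun t : ℝ => b * ρ (q - t • e)) '' Set.Icc (-T) T :=
    intermediate_value_Icc' (by linarith) hg ⟨by linarith, by linarith⟩
  refine ⟨t, ?_, (mul_eq_zero.1 hzero).resolve_left he⟩
  calc |t| ≤ T := abs_le.2 ht
    _ = 2 / |b| * |ρ q| := by rw [hT]; ring

/-- A function that vanishes to order exactly `k` along the smooth hypersurface `ρ = 0` is
`c * ρ ^ k` to leading order. -/
theorem AnalyticAt.exists_isBigO_sub_mul_pow {R ρ : E → ℝ} {p e : E} {k : ℕ} (hk : 1 ≤ k)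
    (hR : AnalyticAt ℝ R p) (hρ : AnalyticAt ℝ ρ p) (hρ0 : ρ p = 0) (he : fderiv ℝ ρ p e ≠ 0)
    (hvan : ∀ᶠ q in 𝓝 p, ρ q = 0 → ∀ j < k, iteratedDirDeriv e j R q = 0)
    (hne : iteratedDirDeriv e k R p ≠ 0) :
    ∃ c : ℝ, c ≠ 0 ∧ (fun q => R q - c * ρ q ^ k) =O[𝓝 p] fun q => ‖q - p‖ * ‖ρ q‖ ^ k := by
  set b := fderiv ℝ ρ p e with hb
  set A := iteratedDirDeriv e k R p with hA
  have hd1 : iteratedDirDeriv e 1 ρ p = b := by rw [iteratedDirDeriv_succ]; rfl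
  obtain ⟨C, hC, hτ⟩ := hρ.hasStrictFDerivAt.exists_eventually_zero_along hρ0 he
  have : ∃ τ : E → ℝ, ∀ᶠ q in 𝓝 p, |τ q| ≤ C * |ρ q| ∧ ρ (q - τ q • e) = 0 := by
    classical
    refine ⟨fun q => if h : ∃ τ : ℝ, |τ| ≤ C * |ρ q| ∧ ρ (q - τ • e) = 0 then h.choose else 0, ?_⟩
    filter_upwards [hτ] with q hq
    rw [dif_pos hq]
    exact hq.choose_spec
  obtain ⟨τ, hτ⟩ := this
  have hτρ : τ =O[𝓝 p] ρ := Asymptotics.IsBigO.of_bound C (hτ.mono fun q hq => hq.1)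
  have hρp : ρ =O[𝓝 p] fun q => q - p := by
    have := hρ.differentiableAt.hasFDerivAt.isBigO_sub
    simpa [hρ0] using this
  have hτp : τ =O[𝓝 p] fun q => q - p := hτρ.trans hρp
  have hmO : (fun q => q - τ q • e - p) =O[𝓝 p] fun q => q - p := by
    have h1 : (fun q => τ q • e) =O[𝓝 p] fun q => q - p := by
      refine Asymptotics.IsBigO.trans (g := fun q => τ q) ?_ hτp
      refine Asymptotics.IsBigO.of_bound ‖e‖ (Eventually.of_forall fun q => ?_)
      rw [norm_smul, mul_comm]
    exact ((Asymptotics.isBigO_refl _ _).sub h1).congr_left fun q => by abel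
  have hsub : Tendsto (fun q => q - p) (𝓝 p) (𝓝 0) := by
    have : Continuous fun q => q - p := by fun_prop
    simpa using this.tendsto p
  have hm0 : Tendsto (fun q => q - τ q • e) (𝓝 p) (𝓝 p) := by
    have := (hmO.trans_tendsto hsub).add_const p
    simpa using this
  -- Taylor's formula on the segment from the foot `q - τ q • e` of `q` to `q`
  have htaylor : ∀ (u : E → ℝ) (k : ℕ), 1 ≤ k → AnalyticAt ℝ u p →
      (∀ᶠ q in 𝓝 p, ρ q = 0 → ∀ j < k, iteratedDirDeriv e j u q = 0) →
      (fun q => u q - iteratedDirDeriv e k u p * τ q ^ k / k.factorial) =O[𝓝 p]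
        fun q => ‖q - p‖ * τ q ^ k := by
    intro u k hk hu hvan
    obtain ⟨C', hC', δ, hδ, hest⟩ := hu.exists_abs_sub_iteratedDirDeriv_le e hk
    have hev : ∀ᶠ q in 𝓝 p, ‖q - p‖ < δ := by
      have := hsub.norm.eventually_lt (tendsto_const_nhds (x := δ)) (by simpa using hδ)
      exact this
    have h1 : (fun q => u q - iteratedDirDeriv e k u p * τ q ^ k / k.factorial) =O[𝓝 p]
        fun q => (‖q - τ q • e - p‖ + ‖q - p‖) * τ q ^ k := by
      refine Asymptotics.IsBigO.of_bound C' ?_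
      filter_upwards [hτ, hev, hm0.eventually hev, hm0.eventually hvan] with q hq hq1 hq2 hq3
      have := hest (q - τ q • e) (τ q) hq2 (by simpa using hq1) (hq3 hq.2)
      rw [sub_add_cancel] at this
      rw [norm_mul, norm_pow, Real.norm_eq_abs, Real.norm_eq_abs, Real.norm_eq_abs,
        abs_of_nonneg (by positivity : 0 ≤ ‖q - τ q • e - p‖ + ‖q - p‖), ← mul_assoc]
      exact this
    refine h1.trans (Asymptotics.IsBigO.mul ?_ (Asymptotics.isBigO_refl _ _))
    exact (hmO.norm_norm).add (Asymptotics.isBigO_refl _ _)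
  have hRτ := htaylor R k hk hR hvan
  have hρτ : (fun q => ρ q - b * τ q) =O[𝓝 p] fun q => ‖q - p‖ * τ q := by
    have := htaylor ρ 1 le_rfl hρ (Eventually.of_forall fun q hq j hj => by
      obtain rfl : j = 0 := by omega
      exact hq)
    simpa [hd1] using this
  have hbounded : (fun q => ‖q - p‖) =O[𝓝 p] fun _ => (1 : ℝ) := hsub.norm.isBigO_one ℝ
  have hρτ' : ρ =O[𝓝 p] τ := by
    have h1 : (fun q => ‖q - p‖ * τ q) =O[𝓝 p] τ := by
      simpa using hbounded.mul (Asymptotics.isBigO_refl τ (𝓝 p))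
    have h2 : (fun q => b * τ q) =O[𝓝 p] τ := (Asymptotics.isBigO_refl τ _).const_mul_left b
    exact ((hρτ.trans h1).add h2).congr_left fun q => by ring
  have hpow : (fun q => ρ q ^ k - (b * τ q) ^ k) =O[𝓝 p] fun q => ‖q - p‖ * τ q ^ k := by
    have h2 : (fun q => b * τ q) =O[𝓝 p] τ := (Asymptotics.isBigO_refl τ _).const_mul_left b
    refine (Asymptotics.IsBigO.pow_sub_pow hρτ hρτ' h2 k).congr_right fun q => ?_
    rw [mul_assoc, ← pow_succ', Nat.sub_add_cancel hk]
  have hfac : (k.factorial : ℝ) ≠ 0 := by exact_mod_cast Nat.factorial_ne_zero k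
  refine ⟨A / (k.factorial * b ^ k), div_ne_zero hne (mul_ne_zero hfac (pow_ne_zero _ he)), ?_⟩
  have h1 : (fun q => R q - A / (k.factorial * b ^ k) * ρ q ^ k) =O[𝓝 p]
      fun q => ‖q - p‖ * τ q ^ k := by
    refine (hRτ.sub (hpow.const_mul_left (A / (k.factorial * b ^ k)))).congr_left fun q => ?_
    rw [mul_pow]
    field_simp
    ring
  refine h1.trans ((Asymptotics.isBigO_refl _ _).mul ?_)
  exact (hτρ.pow k).trans (Asymptotics.isBigO_of_le _ fun q => by simp)

/-- An analytic function that is not locally zero at a point of the smooth hypersurface `ρ = 0`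
vanishes to constant finite order along the hypersurface near some nearby point: take a point
where the order is least. -/
theorem AnalyticAt.exists_order_along {R ρ : E → ℝ} {p e : E} {W : Set E} (hW : W ∈ 𝓝 p)
    (hR : AnalyticAt ℝ R p) (hρ : AnalyticAt ℝ ρ p) (hρ0 : ρ p = 0) (he : fderiv ℝ ρ p e ≠ 0)
    (hne : ¬ R =ᶠ[𝓝 p] 0) :
    ∃ p' ∈ W, ρ p' = 0 ∧ ∃ k, iteratedDirDeriv e k R p' ≠ 0 ∧
      ∀ᶠ q in 𝓝 p', ρ q = 0 → ∀ j < k, iteratedDirDeriv e j R q = 0 := by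
  obtain ⟨δ, hδ, hball⟩ := Metric.eventually_nhds_iff_ball.1
    (hR.eventually_analyticAt.and hW)
  have han : AnalyticOnNhd ℝ R (Metric.ball p δ) := fun q hq => (hball q hq).1
  have hex : ∃ j, ∃ q ∈ Metric.ball p δ, ρ q = 0 ∧ iteratedDirDeriv e j R q ≠ 0 := by
    by_contra! hcon
    refine hne ?_
    obtain ⟨C, hC, hτ⟩ := hρ.hasStrictFDerivAt.exists_eventually_zero_along hρ0 he
    have hsmall : ∀ᶠ q in 𝓝 p, ‖q - p‖ + C * |ρ q| * ‖e‖ < δ := by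
      have h1 : ContinuousAt (fun q => ‖q - p‖ + C * |ρ q| * ‖e‖) p := by
        have := hρ.continuousAt
        fun_prop
      refine h1.eventually_lt continuousAt_const ?_
      simpa [hρ0] using hδ
    filter_upwards [hτ, hsmall] with q ⟨τ, hτ, hτ0⟩ hq
    have hqmem : q ∈ Metric.ball p δ := by
      rw [mem_ball_iff_norm]
      have : 0 ≤ C * |ρ q| * ‖e‖ := by positivity
      linarith
    set m := q - τ • e with hm
    have hmmem : m ∈ Metric.ball p δ := by
      rw [mem_ball_iff_norm]
      calc ‖m - p‖ = ‖(q - p) - τ • e‖ := by rw [hm]; congr 1; abel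
        _ ≤ ‖q - p‖ + ‖τ • e‖ := norm_sub_le _ _
        _ ≤ ‖q - p‖ + C * |ρ q| * ‖e‖ := by
            rw [norm_smul]
            gcongr
            exact hτ
        _ < δ := hq
    set S := (AffineMap.lineMap m (m + e) : ℝ →ᵃ[ℝ] E) ⁻¹' Metric.ball p δ with hS
    have hSmem : ∀ t : ℝ, t ∈ S ↔ m + t • e ∈ Metric.ball p δ := fun t => by
      simp [hS, AffineMap.lineMap_apply, add_comm]
    have hSconv : Convex ℝ S := (convex_ball p δ).affine_preimage _
    have hg : AnalyticOnNhd ℝ (fun t : ℝ => R (m + t • e)) S := fun t ht =>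
      (han _ ((hSmem t).1 ht)).comp_line
    have h0S : (0 : ℝ) ∈ S := (hSmem 0).2 (by simpa using hmmem)
    have htop : analyticOrderAt (fun t : ℝ => R (m + t • e)) 0 = ⊤ := by
      refine ENat.eq_top_iff_forall_ge.2 fun n => ?_
      rw [natCast_le_analyticOrderAt_iff_iteratedDeriv_eq_zero (hg 0 h0S)]
      intro j _
      rw [iteratedDeriv_comp_line_eq_iteratedDirDeriv Metric.isOpen_ball han m e j 0
        ((hSmem 0).1 h0S)]
      simpa using hcon j m hmmem hτ0
    have hzero := hg.eqOn_zero_of_preconnected_of_eventuallyEq_zero hSconv.isPreconnected h0S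
      (analyticOrderAt_eq_top.1 htop) ((hSmem τ).2 (by simpa [hm] using hqmem))
    simpa [hm] using hzero
  classical
  obtain ⟨p', hp', hρp', hkne⟩ := Nat.find_spec hex
  refine ⟨p', (hball p' hp').2, hρp', Nat.find hex, hkne, ?_⟩
  filter_upwards [Metric.isOpen_ball.mem_nhds hp'] with q hq hρq j hj
  have := Nat.find_min hex hj
  push Not at this
  exact this q hq hρq

end

/-! ### Complex parts of the differential and the Hessian -/

section
variable {m : ℕ}

theorem isLinearMap_complex_of_real {E : Type*} [AddCommGroup E] [Module ℂ E] [Module ℝ E]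
    [IsScalarTower ℝ ℂ E] {φ : E → ℂ} (hadd : ∀ v w, φ (v + w) = φ v + φ w)
    (hreal : ∀ (a : ℝ) v, φ (a • v) = a * φ v) {J : ℂ}
    (hI : ∀ v, φ (Complex.I • v) = J * φ v) (z : ℂ) (v : E) :
    φ (z • v) = (z.re + z.im * J) * φ v := by
  have h : z • v = z.re • v + z.im • (Complex.I • v) := by
    conv_lhs => rw [← Complex.re_add_im z]
    have hc : ∀ (a : ℝ) (u : E), (a : ℂ) • u = a • u := fun a u => algebraMap_smul ℂ a u
    rw [add_smul, mul_smul, hc, hc]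
  rw [h, hadd, hreal, hreal, hI]
  ring

/-- The complex-linear part `v ↦ ∑ j, ρ_{Z_j} v_j` of half the real differential `D` of `ρ`. -/
noncomputable def holomorphicDifferential (D : CSpace m →L[ℝ] ℝ) : CSpace m →ₗ[ℂ] ℂ where
  toFun v := ((D v : ℂ) - Complex.I * D (Complex.I • v)) / 2
  map_add' v w := by
    simp only [smul_add, map_add, Complex.ofReal_add]
    ring
  map_smul' z v := by
    have h := isLinearMap_complex_of_real
      (φ := fun v => ((D v : ℂ) - Complex.I * D (Complex.I • v)) / 2) (J := Complex.I)
      (fun v w => by simp only [smul_add, map_add, Complex.ofReal_add]; ring)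
      (fun a v => by
        simp only [smul_comm Complex.I a, map_smul, smul_eq_mul, Complex.ofReal_mul]; ring)
      (fun v => by
        simp only [smul_smul, Complex.I_mul_I, neg_smul, one_smul, map_neg, Complex.ofReal_neg]
        linear_combination (1/2 * (D (Complex.I • v) : ℂ)) * Complex.I_sq) z v
    rw [smul_eq_mul, RingHom.id_apply, h, Complex.re_add_im]

theorem holomorphicDifferential_apply (D : CSpace m →L[ℝ] ℝ) (v : CSpace m) :
    holomorphicDifferential D v = ((D v : ℂ) - Complex.I * D (Complex.I • v)) / 2 := rfl

theorem apply_eq_two_mul_re_holomorphicDifferential (D : CSpace m →L[ℝ] ℝ) (v : CSpace m) :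
    D v = 2 * (holomorphicDifferential D v).re := by
  rw [holomorphicDifferential_apply]
  simp
  ring

theorem exists_holomorphicDifferential_eq_one {D : CSpace m →L[ℝ] ℝ} (hD : D ≠ 0) :
    ∃ e, holomorphicDifferential D e = 1 := by
  have : ∃ v, holomorphicDifferential D v ≠ 0 := by
    by_contra! h
    exact hD (ContinuousLinearMap.ext fun v => by
      rw [apply_eq_two_mul_re_holomorphicDifferential, h]; simp)
  obtain ⟨v, hv⟩ := this
  exact ⟨(holomorphicDifferential D v)⁻¹ • v, by rw [map_smul, smul_eq_mul, inv_mul_cancel₀ hv]⟩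

/-- The complex-bilinear part of a real bilinear form. -/
noncomputable def bilinearPart (B : CSpace m →L[ℝ] CSpace m →L[ℝ] ℝ) :
    CSpace m →ₗ[ℂ] CSpace m →ₗ[ℂ] ℂ :=
  LinearMap.mk₂ ℂ (fun v w => ((B v w : ℂ) - B (Complex.I • v) (Complex.I • w)) / 4 -
      Complex.I / 4 * (B v (Complex.I • w) + B (Complex.I • v) w))
    (fun v v' w => by
      simp only [smul_add, map_add, ContinuousLinearMap.add_apply, Complex.ofReal_add]; ring)
    (fun z v w => by
      have h := isLinearMap_complex_of_real
        (φ := fun v => ((B v w : ℂ) - B (Complex.I • v) (Complex.I • w)) / 4 -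
          Complex.I / 4 * (B v (Complex.I • w) + B (Complex.I • v) w)) (J := Complex.I)
        (fun v v' => by
          simp only [smul_add, map_add, ContinuousLinearMap.add_apply, Complex.ofReal_add]; ring)
        (fun a v => by
          simp only [smul_comm Complex.I a, map_smul, ContinuousLinearMap.smul_apply, smul_eq_mul,
            Complex.ofReal_mul]; ring)
        (fun v => by
          simp only [smul_smul, Complex.I_mul_I, neg_smul, one_smul, map_neg,
            ContinuousLinearMap.neg_apply, Complex.ofReal_neg]
          linear_combination (1/4 * ((B v (Complex.I • w) : ℂ) + B (Complex.I • v) w)) *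
            Complex.I_sq) z v
      rw [smul_eq_mul, h, Complex.re_add_im])
    (fun v w w' => by
      simp only [smul_add, map_add, Complex.ofReal_add]; ring)
    (fun z v w => by
      have h := isLinearMap_complex_of_real
        (φ := fun w => ((B v w : ℂ) - B (Complex.I • v) (Complex.I • w)) / 4 -
          Complex.I / 4 * (B v (Complex.I • w) + B (Complex.I • v) w)) (J := Complex.I)
        (fun w w' => by
          simp only [smul_add, map_add, Complex.ofReal_add]; ring)
        (fun a w => by
          simp only [smul_comm Complex.I a, map_smul, smul_eq_mul, Complex.ofReal_mul]; ring)
        (fun w => by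
          simp only [smul_smul, Complex.I_mul_I, neg_smul, one_smul, map_neg, Complex.ofReal_neg]
          linear_combination (1/4 * ((B v (Complex.I • w) : ℂ) + B (Complex.I • v) w)) *
            Complex.I_sq) z w
      rw [smul_eq_mul, h, Complex.re_add_im])

/-- The sesquilinear part of a real bilinear form; for the real Hessian of `ρ` this is the complex
Hessian `∑ j k, ρ_{Z_j Z̄_k} v_j conj(w_k)`. -/
noncomputable def sesquilinearPart (B : CSpace m →L[ℝ] CSpace m →L[ℝ] ℝ) :
    CSpace m →ₗ[ℂ] CSpace m →ₛₗ[starRingEnd ℂ] ℂ :=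
  LinearMap.mk₂'ₛₗ (RingHom.id ℂ) (starRingEnd ℂ)
    (fun v w => ((B v w : ℂ) + B (Complex.I • v) (Complex.I • w)) / 4 +
      Complex.I / 4 * (B v (Complex.I • w) - B (Complex.I • v) w))
    (fun v v' w => by
      simp only [smul_add, map_add, ContinuousLinearMap.add_apply, Complex.ofReal_add]; ring)
    (fun z v w => by
      have h := isLinearMap_complex_of_real
        (φ := fun v => ((B v w : ℂ) + B (Complex.I • v) (Complex.I • w)) / 4 +
          Complex.I / 4 * (B v (Complex.I • w) - B (Complex.I • v) w)) (J := Complex.I)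
        (fun v v' => by
          simp only [smul_add, map_add, ContinuousLinearMap.add_apply, Complex.ofReal_add]; ring)
        (fun a v => by
          simp only [smul_comm Complex.I a, map_smul, ContinuousLinearMap.smul_apply, smul_eq_mul,
            Complex.ofReal_mul]; ring)
        (fun v => by
          simp only [smul_smul, Complex.I_mul_I, neg_smul, one_smul, map_neg,
            ContinuousLinearMap.neg_apply, Complex.ofReal_neg]
          linear_combination (-1/4 * ((B v (Complex.I • w) : ℂ) - B (Complex.I • v) w)) *
            Complex.I_sq) z v
      rw [smul_eq_mul, RingHom.id_apply, h, Complex.re_add_im])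
    (fun v w w' => by
      simp only [smul_add, map_add, Complex.ofReal_add]; ring)
    (fun z v w => by
      have h := isLinearMap_complex_of_real
        (φ := fun w => ((B v w : ℂ) + B (Complex.I • v) (Complex.I • w)) / 4 +
          Complex.I / 4 * (B v (Complex.I • w) - B (Complex.I • v) w)) (J := -Complex.I)
        (fun w w' => by
          simp only [smul_add, map_add, Complex.ofReal_add]; ring)
        (fun a w => by
          simp only [smul_comm Complex.I a, map_smul, smul_eq_mul, Complex.ofReal_mul]; ring)
        (fun w => by
          simp only [smul_smul, Complex.I_mul_I, neg_smul, one_smul, map_neg, Complex.ofReal_neg]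
          linear_combination (1/4 * ((B v (Complex.I • w) : ℂ) - B (Complex.I • v) w)) *
            Complex.I_sq) z w
      have hz : conj z = z.re + z.im * -Complex.I := by
        apply Complex.ext <;> simp
      rw [smul_eq_mul, h, hz])

theorem bilinearPart_apply (B : CSpace m →L[ℝ] CSpace m →L[ℝ] ℝ) (v w : CSpace m) :
    bilinearPart B v w = ((B v w : ℂ) - B (Complex.I • v) (Complex.I • w)) / 4 -
      Complex.I / 4 * (B v (Complex.I • w) + B (Complex.I • v) w) := rfl

theorem sesquilinearPart_apply (B : CSpace m →L[ℝ] CSpace m →L[ℝ] ℝ) (v w : CSpace m) :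
    sesquilinearPart B v w = ((B v w : ℂ) + B (Complex.I • v) (Complex.I • w)) / 4 +
      Complex.I / 4 * (B v (Complex.I • w) - B (Complex.I • v) w) := rfl

theorem conj_sesquilinearPart {B : CSpace m →L[ℝ] CSpace m →L[ℝ] ℝ} (hB : ∀ v w, B v w = B w v)
    (v w : CSpace m) : conj (sesquilinearPart B v w) = sesquilinearPart B w v := by
  rw [sesquilinearPart_apply, sesquilinearPart_apply, hB w v, hB (Complex.I • w) (Complex.I • v),
    hB w (Complex.I • v), hB (Complex.I • w) v]
  simp only [map_add, map_div₀, map_mul, map_sub, Complex.conj_ofReal, Complex.conj_I]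
  have h4 : conj (4 : ℂ) = 4 := Complex.conj_ofNat 4
  rw [h4]
  ring

/-- The real quadratic form is the sum of its pluriharmonic and its hermitian part. -/
theorem half_apply_self_eq (B : CSpace m →L[ℝ] CSpace m →L[ℝ] ℝ) (v : CSpace m) :
    B v v / 2 = (bilinearPart B v v).re + (sesquilinearPart B v v).re := by
  rw [bilinearPart_apply, sesquilinearPart_apply]
  simp
  ring

theorem hasFDerivAt_ofReal_comp {ρ : CSpace m → ℝ} {q : CSpace m} (hρ : DifferentiableAt ℝ ρ q) :
    HasFDerivAt (fun Z => (ρ Z : ℂ)) (Complex.ofRealCLM.comp (fderiv ℝ ρ q)) q :=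
  Complex.ofRealCLM.hasFDerivAt.comp q hρ.hasFDerivAt

theorem smul_single_one_eq (j : Fin m) :
    (Complex.I • (Pi.single j 1 : CSpace m)) = Pi.single j Complex.I := by
  rw [← Pi.single_smul, smul_eq_mul, mul_one]

theorem wirtinger_ofReal {ρ : CSpace m → ℝ} {q : CSpace m} (hρ : DifferentiableAt ℝ ρ q)
    (j : Fin m) : wirtinger j (fun Z => (ρ Z : ℂ)) q =
      holomorphicDifferential (fderiv ℝ ρ q) (Pi.single j 1) := by
  rw [wirtinger, (hasFDerivAt_ofReal_comp hρ).fderiv, holomorphicDifferential_apply,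
    smul_single_one_eq]
  rfl

theorem sum_smul_single_one (v : CSpace m) : v = ∑ j, v j • (Pi.single j 1 : CSpace m) := by
  conv_lhs => rw [← Finset.univ_sum_single v]
  refine Finset.sum_congr rfl fun j _ => ?_
  rw [← Pi.single_smul, smul_eq_mul, mul_one]

theorem mem_holTangentSpace_iff {ρ : CSpace m → ℝ} {q : CSpace m} (hρ : DifferentiableAt ℝ ρ q)
    {v : CSpace m} : v ∈ holTangentSpace ρ q ↔ holomorphicDifferential (fderiv ℝ ρ q) v = 0 := by
  have : holomorphicDifferential (fderiv ℝ ρ q) v =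
      ∑ j, wirtinger j (fun Z => (ρ Z : ℂ)) q * v j := by
    conv_lhs => rw [sum_smul_single_one v]
    rw [map_sum]
    refine Finset.sum_congr rfl fun j _ => ?_
    rw [map_smul, smul_eq_mul, wirtinger_ofReal hρ, mul_comm]
  rw [holTangentSpace, LinearMap.mem_ker, this]
  simp [LinearMap.sum_apply]

theorem leviForm_eq_sesquilinearPart {ρ : CSpace m → ℝ} {q : CSpace m} (hρ : AnalyticAt ℝ ρ q)
    (v w : CSpace m) :
    leviForm ρ q v w = sesquilinearPart (fderiv ℝ (fderiv ℝ ρ) q) v w := by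
  have hw : ∀ j k, wirtinger j (wirtingerBar k fun Z => (ρ Z : ℂ)) q =
      sesquilinearPart (fderiv ℝ (fderiv ℝ ρ) q) (Pi.single j 1) (Pi.single k 1) := by
    intro j k
    have hev : (wirtingerBar k fun Z => (ρ Z : ℂ)) =ᶠ[𝓝 q] fun x =>
        ((fderiv ℝ ρ x (Pi.single k 1) : ℂ) +
          Complex.I * (fderiv ℝ ρ x (Pi.single k Complex.I) : ℂ)) / 2 := by
      filter_upwards [hρ.eventually_analyticAt] with x hx
      rw [wirtingerBar, (hasFDerivAt_ofReal_comp hx.differentiableAt).fderiv]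
      rfl
    have hd : ∀ u : CSpace m, HasFDerivAt (fun x => (fderiv ℝ ρ x u : ℂ))
        (Complex.ofRealCLM.comp ((ContinuousLinearMap.apply ℝ ℝ u).comp
          (fderiv ℝ (fderiv ℝ ρ) q))) q := fun u =>
      Complex.ofRealCLM.hasFDerivAt.comp q ((ContinuousLinearMap.apply ℝ ℝ u).hasFDerivAt.comp q
        hρ.fderiv.differentiableAt.hasFDerivAt)
    have hF := (((hd (Pi.single k 1)).add ((hd (Pi.single k Complex.I)).const_mul
      Complex.I)).mul_const (2 : ℂ)⁻¹)
    have hfd := hev.fderiv_eq (𝕜 := ℝ)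
    simp only [div_eq_mul_inv] at hfd
    rw [wirtinger, hfd]
    erw [hF.fderiv]
    rw [sesquilinearPart_apply, smul_single_one_eq, smul_single_one_eq]
    simp only [ContinuousLinearMap.smul_apply, ContinuousLinearMap.add_apply,
      ContinuousLinearMap.comp_apply, ContinuousLinearMap.apply_apply, Complex.ofRealCLM_apply,
      smul_eq_mul]
    linear_combination (-1/4 * (fderiv ℝ (fderiv ℝ ρ) q (Pi.single j Complex.I)
      (Pi.single k Complex.I) : ℂ)) * Complex.I_sq
  conv_rhs => rw [sum_smul_single_one v, sum_smul_single_one w]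
  simp only [leviForm, map_sum, LinearMap.sum_apply, map_smul, LinearMap.smul_apply, hw,
    LinearMap.map_smulₛₗ, smul_eq_mul]
  rw [Finset.sum_comm]
  refine Finset.sum_congr rfl fun k _ => ?_
  rw [Finset.mul_sum]
  exact Finset.sum_congr rfl fun j _ => by ring

end

/-! ### Diagonalization and semicontinuity of the Levi form -/

section

/-- Orthogonal diagonalization of a hermitian matrix `L`, in the form needed for sesquilinear
forms that are conjugate-linear in the second variable. -/
theorem Matrix.IsHermitian.exists_sum_mul_conj_eq_eigenvalues {ι : Type*} [Fintype ι]
    [DecidableEq ι] {L : Matrix ι ι ℂ} (hL : L.IsHermitian) :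
    ∃ x : ι → ι → ℂ, ∀ a b, ∑ j, ∑ k, x a j * conj (x b k) * L j k =
      if a = b then (hL.eigenvalues a : ℂ) else 0 := by
  refine ⟨fun a j => conj (hL.eigenvectorBasis a j), fun a b => ?_⟩
  have h1 : ∀ j, ∑ k, L j k * hL.eigenvectorBasis b k =
      hL.eigenvalues b * hL.eigenvectorBasis b j := by
    intro j
    have := congrFun (hL.mulVec_eigenvectorBasis b) j
    simpa [Matrix.mulVec, dotProduct] using this
  have h2 : ∑ j, conj (hL.eigenvectorBasis a j) * hL.eigenvectorBasis b j =
      if a = b then 1 else 0 := by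
    have := orthonormal_iff_ite.1 hL.eigenvectorBasis.orthonormal a b
    rw [← this, PiLp.inner_apply]
    exact Finset.sum_congr rfl fun j _ => by simp [mul_comm]
  calc _ = ∑ j, conj (hL.eigenvectorBasis a j) *
        ∑ k, L j k * hL.eigenvectorBasis b k := by
        refine Finset.sum_congr rfl fun j _ => ?_
        rw [Finset.mul_sum]
        refine Finset.sum_congr rfl fun k _ => ?_
        rw [Complex.conj_conj]
        ring
    _ = hL.eigenvalues b * ∑ j, conj (hL.eigenvectorBasis a j) * hL.eigenvectorBasis b j := by
        rw [Finset.mul_sum]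
        refine Finset.sum_congr rfl fun j _ => ?_
        rw [h1]
        ring
    _ = _ := by
        rw [h2]
        split_ifs with h
        · rw [h, mul_one]
        · rw [mul_zero]

theorem Matrix.IsHermitian.card_eigenvalues_ne_zero {n e : ℕ} {L : Matrix (Fin n) (Fin n) ℂ}
    (hL : L.IsHermitian) (he : L.charpoly.roots.count 0 = e) :
    Fintype.card {i // hL.eigenvalues i ≠ 0} = n - e := by
  classical
  rw [hL.roots_charpoly_eq_eigenvalues, Multiset.count_map] at he
  have h1 : Multiset.card (Multiset.filter (fun a => (0 : ℂ) = (RCLike.ofReal ∘ hL.eigenvalues) a)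
      (Finset.univ : Finset (Fin n)).val) = (Finset.univ.filter fun i => hL.eigenvalues i = 0).card := by
    rw [← Finset.filter_val, Finset.card_val]
    congr 1
    ext i
    simp only [Function.comp_apply, Finset.mem_filter, Finset.mem_univ, true_and]
    exact ⟨fun h => RCLike.ofReal_eq_zero.1 h.symm, fun h => by rw [h, RCLike.ofReal_zero]⟩
  rw [h1] at he
  have h2 := Finset.card_filter_add_card_filter_not (s := (Finset.univ : Finset (Fin n)))
    (fun i => hL.eigenvalues i = 0)
  rw [he, Finset.card_univ, Fintype.card_fin] at h2
  rw [Fintype.card_subtype]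
  simp only [ne_eq]
  omega

variable {n : ℕ} {ρ : CSpace n → ℝ} {p : CSpace n}

theorem AnalyticAt.fderiv_fderiv_symm (hρ : AnalyticAt ℝ ρ p) (v w : CSpace n) :
    fderiv ℝ (fderiv ℝ ρ) p v w = fderiv ℝ (fderiv ℝ ρ) p w v :=
  (hρ.contDiffAt (n := 2).isSymmSndFDerivAt (by simp)).eq v w

theorem sesquilinearPart_sum_smul {ι : Type*} [Fintype ι]
    (B : CSpace n →L[ℝ] CSpace n →L[ℝ] ℝ) (x y : ι → ℂ) (u : ι → CSpace n) :
    sesquilinearPart B (∑ j, x j • u j) (∑ k, y k • u k) =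
      ∑ j, ∑ k, x j * conj (y k) * sesquilinearPart B (u j) (u k) := by
  simp only [map_sum, LinearMap.sum_apply, map_smul, LinearMap.smul_apply, LinearMap.map_smulₛₗ,
    smul_eq_mul]
  rw [Finset.sum_comm]
  refine Finset.sum_congr rfl fun j _ => ?_
  rw [Finset.mul_sum]
  exact Finset.sum_congr rfl fun k _ => by ring

/-- An orthogonal family of complex tangent vectors that diagonalizes the Levi form on its span,
without zero eigenvalues. -/
def IsLeviOrthogonal {r : ℕ} (ρ : CSpace n → ℝ) (q : CSpace n) (v : Fin r → CSpace n)
    (ℓ : Fin r → ℝ) : Prop :=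
  (∀ i, holomorphicDifferential (fderiv ℝ ρ q) (v i) = 0) ∧
    (∀ i j, sesquilinearPart (fderiv ℝ (fderiv ℝ ρ) q) (v i) (v j) =
      if i = j then (ℓ i : ℂ) else 0) ∧ ∀ i, ℓ i ≠ 0

/-- The rank of the Levi form is lower semicontinuous. -/
theorem IsLeviOrthogonal.eventually_exists {r : ℕ} {u : Fin r → CSpace n} {μ : Fin r → ℝ}
    (hρ : AnalyticAt ℝ ρ p) (hd : fderiv ℝ ρ p ≠ 0) (hu : IsLeviOrthogonal ρ p u μ) :
    ∀ᶠ q in 𝓝 p, ∃ (v : Fin r → CSpace n) (ℓ : Fin r → ℝ), IsLeviOrthogonal ρ q v ℓ := by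
  obtain ⟨hu1, hu2, hμ⟩ := hu
  obtain ⟨e, he⟩ := exists_holomorphicDifferential_eq_one hd
  have hDc : ∀ v, ContinuousAt (fun q => holomorphicDifferential (fderiv ℝ ρ q) v) p := by
    intro v
    have := hρ.fderiv.continuousAt
    simp only [holomorphicDifferential_apply]
    fun_prop
  -- project the vectors at `p` to the complex tangent spaces at nearby points along `e`
  set w : CSpace n → Fin r → CSpace n := fun q i => u i -
    (holomorphicDifferential (fderiv ℝ ρ q) (u i) / holomorphicDifferential (fderiv ℝ ρ q) e) • e
    with hw
  have hwc : ∀ i, ContinuousAt (fun q => w q i) p := fun i =>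
    continuousAt_const.sub (((hDc _).div (hDc _) (by rw [he]; exact one_ne_zero)).smul
      continuousAt_const)
  have hwp : ∀ i, w p i = u i := fun i => by simp [hw, hu1 i]
  set G : CSpace n → Matrix (Fin r) (Fin r) ℂ := fun q => Matrix.of fun i j =>
    sesquilinearPart (fderiv ℝ (fderiv ℝ ρ) q) (w q i) (w q j) with hG
  have hGc : ContinuousAt G p := by
    refine continuousAt_pi.2 fun i => continuousAt_pi.2 fun j => ?_
    have h1 := hρ.fderiv.fderiv.continuousAt
    have h2 := hwc i
    have h3 := hwc j
    simp only [hG, Matrix.of_apply, sesquilinearPart_apply]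
    fun_prop
  have hdet : ContinuousAt (fun q => (G q).det) p :=
    (Continuous.matrix_det continuous_id).continuousAt.comp hGc
  have hdetp : (G p).det ≠ 0 := by
    have : G p = Matrix.diagonal fun i => (μ i : ℂ) := by
      ext i j
      simp only [hG, Matrix.of_apply, hwp, hu2, Matrix.diagonal_apply]
    rw [this, Matrix.det_diagonal]
    exact Finset.prod_ne_zero_iff.2 fun i _ => by exact_mod_cast hμ i
  have hene : ∀ᶠ q in 𝓝 p, holomorphicDifferential (fderiv ℝ ρ q) e ≠ 0 :=
    (hDc e).eventually_ne (by rw [he]; exact one_ne_zero)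
  filter_upwards [hρ.eventually_analyticAt, hdet.eventually_ne hdetp, hene] with q hq hdq heq
  have hherm : (G q).IsHermitian := by
    ext i j
    rw [Matrix.conjTranspose_apply, RCLike.star_def]
    exact conj_sesquilinearPart hq.fderiv_fderiv_symm _ _
  obtain ⟨x, hx⟩ := hherm.exists_sum_mul_conj_eq_eigenvalues
  refine ⟨fun a => ∑ j, x a j • w q j, hherm.eigenvalues, fun a => ?_, fun a b => ?_, fun a => ?_⟩
  · rw [map_sum]
    refine Finset.sum_eq_zero fun j _ => ?_
    have : holomorphicDifferential (fderiv ℝ ρ q) (w q j) = 0 := by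
      simp only [hw, map_sub, map_smul, smul_eq_mul]
      rw [div_mul_cancel₀ _ heq, sub_self]
    rw [map_smul, this, smul_zero]
  · rw [sesquilinearPart_sum_smul]
    exact hx a b
  · rw [hherm.det_eq_prod_eigenvalues] at hdq
    have := Finset.prod_ne_zero_iff.1 hdq a (Finset.mem_univ a)
    exact fun h => this (by simp [h])

theorem exists_isLeviOrthogonal {n e₀ : ℕ} {M : Set (CSpace (n + 1))} {p : CSpace (n + 1)}
    (h : LeviZeroEigenvalues M p e₀) :
    ∃ ρ : CSpace (n + 1) → ℝ, IsLocalDefiningFunction M p ρ ∧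
      ∃ (v : Fin (n - e₀) → CSpace (n + 1)) (ℓ : Fin (n - e₀) → ℝ), IsLeviOrthogonal ρ p v ℓ := by
  obtain ⟨L, ⟨ρ, hρ, b, hb⟩, hL⟩ := h
  refine ⟨ρ, hρ, ?_⟩
  have hb' : ∀ j k, L j k =
      sesquilinearPart (fderiv ℝ (fderiv ℝ ρ) p) (b j) (b k) := fun j k => by
    rw [hb, leviForm_eq_sesquilinearPart hρ.1]
  have hherm : L.IsHermitian := by
    ext i j
    rw [Matrix.conjTranspose_apply, RCLike.star_def, hb', hb']
    exact conj_sesquilinearPart hρ.1.fderiv_fderiv_symm _ _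
  obtain ⟨x, hx⟩ := hherm.exists_sum_mul_conj_eq_eigenvalues
  have σ : Fin (n - e₀) ≃ {i // hherm.eigenvalues i ≠ 0} :=
    Fintype.equivOfCardEq (by rw [hherm.card_eigenvalues_ne_zero hL, Fintype.card_fin])
  refine ⟨fun a => ∑ j, x (σ a) j • (b j : CSpace (n + 1)), fun a => hherm.eigenvalues (σ a),
    fun a => ?_, fun a a' => ?_, fun a => (σ a).2⟩
  · rw [map_sum]
    refine Finset.sum_eq_zero fun j _ => ?_
    rw [map_smul, (mem_holTangentSpace_iff hρ.1.differentiableAt).1 (b j).2, smul_zero]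
  · rw [sesquilinearPart_sum_smul]
    simp only [← hb', hx]
    have : ((σ a : Fin n) = σ a') ↔ a = a' := by rw [← Subtype.ext_iff, σ.injective.eq_iff]
    simp only [this]
end

/-! ### The defining function along a weighted curve -/

section

theorem AnalyticAt.isBigO_taylor_two {E : Type*} [NormedAddCommGroup E] [NormedSpace ℝ E]
    {ρ : E → ℝ} {p : E} (hρ : AnalyticAt ℝ ρ p) :
    (fun y => ρ (p + y) - (ρ p + fderiv ℝ ρ p y + fderiv ℝ (fderiv ℝ ρ) p y y / 2)) =O[𝓝 0]
      fun y => ‖y‖ ^ 3 := by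
  obtain ⟨P, R, hP⟩ := hρ
  refine (hP.hasFPowerSeriesAt.isBigO_sub_partialSum_pow 3).congr_left fun y => ?_
  have h0 := hP.factorial_smul y 0
  have h1 := hP.factorial_smul y 1
  have h2 := hP.factorial_smul y 2
  rw [iteratedFDeriv_zero_apply] at h0
  rw [iteratedFDeriv_one_apply] at h1
  rw [iteratedFDeriv_two_apply] at h2
  simp only [Nat.factorial, nsmul_eq_mul, Nat.cast_one, one_mul, mul_one, zero_add,
    Nat.cast_ofNat, Nat.succ_eq_add_one, Nat.reduceAdd] at h0 h1 h2
  rw [FormalMultilinearSeries.partialSum, Finset.sum_range_succ, Finset.sum_range_succ,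
    Finset.sum_range_one, h0, h1, ← h2]
  ring

variable {n r : ℕ}

/-- The curve `s ↦ p + ∑ i, s ^ d i v i + (s ^ D - q(s)) e`, whose transverse component is
corrected by the complex-bilinear part `B` of the Hessian so as to remove the pluriharmonic
second order terms of the defining function. -/
noncomputable def leviCurve (p e : CSpace n) (B : CSpace n →L[ℝ] CSpace n →L[ℝ] ℝ)
    (v : Fin r → CSpace n) (d : Fin r → ℕ) (D : ℕ) (s : ℂ) : CSpace n :=
  p + (∑ i, s ^ d i • v i +
    (s ^ D - bilinearPart B (∑ i, s ^ d i • v i) (∑ i, s ^ d i • v i) / 2) • e)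

theorem bilinearPart_sum_smul (B : CSpace n →L[ℝ] CSpace n →L[ℝ] ℝ)
    (x : Fin r → ℂ) (v : Fin r → CSpace n) :
    bilinearPart B (∑ i, x i • v i) (∑ i, x i • v i) =
      ∑ j, ∑ i, x i * x j * bilinearPart B (v i) (v j) := by
  simp only [map_sum, LinearMap.sum_apply, map_smul, LinearMap.smul_apply, smul_eq_mul,
    Finset.mul_sum]
  exact Finset.sum_congr rfl fun j _ => Finset.sum_congr rfl fun i _ => by ring

theorem differentiable_leviCurve (p e : CSpace n) (B : CSpace n →L[ℝ] CSpace n →L[ℝ] ℝ)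
    (v : Fin r → CSpace n) (d : Fin r → ℕ) (D : ℕ) :
    Differentiable ℂ (leviCurve p e B v d D) := by
  unfold leviCurve
  simp only [bilinearPart_sum_smul]
  fun_prop

theorem isBigO_pow_norm_pow {a b : ℕ} (h : b ≤ a) :
    (fun s : ℂ => ‖s‖ ^ a) =O[𝓝 0] fun s => ‖s‖ ^ b := by
  refine Asymptotics.IsBigO.of_bound 1 ?_
  filter_upwards [Metric.ball_mem_nhds (0 : ℂ) one_pos] with s hs
  have hs' : ‖s‖ ≤ 1 := by
    rw [mem_ball_zero_iff] at hs
    exact hs.le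
  simpa using pow_le_pow_of_le_one (norm_nonneg s) hs' h

theorem isBigO_pow {a b : ℕ} (h : b ≤ a) :
    (fun s : ℂ => s ^ a) =O[𝓝 0] fun s => ‖s‖ ^ b :=
  Asymptotics.IsBigO.trans (Asymptotics.isBigO_of_le _ fun s => by simp) (isBigO_pow_norm_pow h)

variable {ρ : CSpace n → ℝ} {p e : CSpace n} {v : Fin r → CSpace n} {ℓ : Fin r → ℝ}
  {d : Fin r → ℕ} {m : ℕ}

theorem isBigO_sum_pow_smul (v : Fin r → CSpace n) (hd : ∀ i, m ≤ d i) :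
    (fun s : ℂ => ∑ i, s ^ d i • v i) =O[𝓝 0] fun s => ‖s‖ ^ m := by
  refine Asymptotics.IsBigO.fun_sum fun i _ => ?_
  have h : (fun _ : ℂ => v i) =O[𝓝 0] fun _ => (1 : ℝ) := Asymptotics.isBigO_const_const _ one_ne_zero _
  simpa using (isBigO_pow (hd i)).smul h

theorem isBigO_transverse (B : CSpace n →L[ℝ] CSpace n →L[ℝ] ℝ) (v : Fin r → CSpace n)
    (hd : ∀ i, m ≤ d i) :
    (fun s : ℂ => s ^ (2 * m) - bilinearPart B (∑ i, s ^ d i • v i) (∑ i, s ^ d i • v i) / 2)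
      =O[𝓝 0] fun s => ‖s‖ ^ (2 * m) := by
  refine (isBigO_pow le_rfl).sub ?_
  simp only [bilinearPart_sum_smul, div_eq_mul_inv, mul_comm _ (2 : ℂ)⁻¹]
  refine Asymptotics.IsBigO.const_mul_left (Asymptotics.IsBigO.fun_sum fun j _ => ?_) _
  refine Asymptotics.IsBigO.fun_sum fun i _ => ?_
  simp only [← pow_add, mul_comm _ (bilinearPart B (v i) (v j))]
  exact (isBigO_pow (by have := hd i; have := hd j; omega)).const_mul_left _

theorem isBigO_leviCurve_sub (B : CSpace n →L[ℝ] CSpace n →L[ℝ] ℝ) (hd : ∀ i, m ≤ d i) :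
    (fun s => leviCurve p e B v d (2 * m) s - p) =O[𝓝 0] fun s => ‖s‖ ^ m := by
  have h : (fun _ : ℂ => e) =O[𝓝 0] fun _ => (1 : ℝ) := Asymptotics.isBigO_const_const _ one_ne_zero _
  have h1 : (fun s : ℂ => (s ^ (2 * m) - bilinearPart B (∑ i, s ^ d i • v i)
      (∑ i, s ^ d i • v i) / 2) • e) =O[𝓝 0] fun s => ‖s‖ ^ (2 * m) := by
    simpa using (isBigO_transverse B v hd).smul h
  refine ((isBigO_sum_pow_smul v hd).add (h1.trans (isBigO_pow_norm_pow (by omega)))).congr_left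
    fun s => ?_
  rw [leviCurve, add_sub_cancel_left]

/-- Along the curve, the defining function is `2 Re s ^ (2 m) + ∑ i, ℓ i |s| ^ (2 d i)` up to
terms of order `3 m`. -/
theorem IsLeviOrthogonal.isBigO_comp_leviCurve (hρ : AnalyticAt ℝ ρ p) (hρ0 : ρ p = 0)
    (he : holomorphicDifferential (fderiv ℝ ρ p) e = 1) (hv : IsLeviOrthogonal ρ p v ℓ)
    (hm : 1 ≤ m) (hd : ∀ i, m ≤ d i) :
    (fun s => ρ (leviCurve p e (fderiv ℝ (fderiv ℝ ρ) p) v d (2 * m) s) -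
      (2 * (s ^ (2 * m)).re + ∑ i, ℓ i * ‖s‖ ^ (2 * d i))) =O[𝓝 0] fun s => ‖s‖ ^ (3 * m) := by
  obtain ⟨hv1, hv2, -⟩ := hv
  set B := fderiv ℝ (fderiv ℝ ρ) p with hB
  set h : ℂ → CSpace n := fun s => ∑ i, s ^ d i • v i with hh
  set z : ℂ → ℂ := fun s => s ^ (2 * m) - bilinearPart B (h s) (h s) / 2 with hz
  have hγ : ∀ s, leviCurve p e B v d (2 * m) s = p + (h s + z s • e) := fun s => rfl
  have hhO : h =O[𝓝 0] fun s => ‖s‖ ^ m := isBigO_sum_pow_smul v hd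
  have hzO : (fun s => z s • e) =O[𝓝 0] fun s => ‖s‖ ^ (2 * m) := by
    have h1 : (fun _ : ℂ => e) =O[𝓝 0] fun _ => (1 : ℝ) :=
      Asymptotics.isBigO_const_const _ one_ne_zero _
    exact ((isBigO_transverse B v hd).smul h1).congr_right fun s => by simp
  have hyO : (fun s => h s + z s • e) =O[𝓝 0] fun s => ‖s‖ ^ m :=
    hhO.add (hzO.trans (isBigO_pow_norm_pow (by omega)))
  have hy0 : Tendsto (fun s => h s + z s • e) (𝓝 0) (𝓝 0) := by
    refine hyO.trans_tendsto ?_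
    have := (by fun_prop : Continuous fun s : ℂ => ‖s‖ ^ m).tendsto 0
    simpa [zero_pow (show m ≠ 0 by omega)] using this
  have hT : (fun s => ρ (leviCurve p e B v d (2 * m) s) - (ρ p + fderiv ℝ ρ p (h s + z s • e) +
      B (h s + z s • e) (h s + z s • e) / 2)) =O[𝓝 0] fun s => ‖s‖ ^ (3 * m) := by
    have h1 := hρ.isBigO_taylor_two.comp_tendsto hy0
    refine h1.trans (((hyO.norm_left).pow 3).congr_right fun s => ?_)
    rw [← pow_mul, mul_comm]
  have hBO : ∀ {f g : ℂ → CSpace n} {a b : ℕ}, f =O[𝓝 0] (fun s => ‖s‖ ^ a) →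
      g =O[𝓝 0] (fun s => ‖s‖ ^ b) → 3 * m ≤ a + b →
      (fun s => B (f s) (g s)) =O[𝓝 0] fun s => ‖s‖ ^ (3 * m) := by
    intro f g a b hf hg hab
    have h1 : (fun s => B (f s) (g s)) =O[𝓝 0] fun s => ‖f s‖ * ‖g s‖ :=
      Asymptotics.IsBigO.of_bound ‖B‖ (Eventually.of_forall fun s => by
        simpa [mul_assoc] using B.le_opNorm₂ (f s) (g s))
    refine h1.trans (((hf.norm_left.mul hg.norm_left).congr_right fun s => ?_).trans
      (isBigO_pow_norm_pow hab))
    rw [pow_add]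
  have hrem := ((hBO hhO hzO (by omega)).add (hBO hzO hhO (by omega))).add
    (hBO hzO hzO (by omega))
  refine (hT.add (hrem.const_mul_left (1 / 2))).congr_left fun s => ?_
  have hDh : fderiv ℝ ρ p (h s) = 0 := by
    rw [apply_eq_two_mul_re_holomorphicDifferential, hh]
    simp [map_sum, hv1]
  have hDz : fderiv ℝ ρ p (z s • e) = 2 * (z s).re := by
    rw [apply_eq_two_mul_re_holomorphicDifferential, map_smul, he, smul_eq_mul, mul_one]
  have hLevi : (sesquilinearPart B (h s) (h s)).re = ∑ i, ℓ i * ‖s‖ ^ (2 * d i) := by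
    have h1 : sesquilinearPart B (h s) (h s) = ((∑ i, ℓ i * ‖s‖ ^ (2 * d i) : ℝ) : ℂ) := by
      rw [hh, sesquilinearPart_sum_smul]
      simp only [hv2, mul_ite, mul_zero, Finset.sum_ite_eq, Finset.mem_univ, if_true]
      push_cast
      refine Finset.sum_congr rfl fun i _ => ?_
      rw [map_pow, ← mul_pow, Complex.mul_conj, Complex.normSq_eq_norm_sq]
      push_cast
      rw [← pow_mul, mul_comm]
    rw [h1, Complex.ofReal_re]
  have hhalf := half_apply_self_eq B (h s)
  have hzre : (z s).re = (s ^ (2 * m)).re - (bilinearPart B (h s) (h s)).re / 2 := by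
    rw [hz]
    simp only [Complex.sub_re]
    congr 1
    exact Complex.div_ofNat_re _ 2
  have hBadd : B (h s + z s • e) (h s + z s • e) = B (h s) (h s) +
      (B (h s) (z s • e) + B (z s • e) (h s) + B (z s • e) (z s • e)) := by
    rw [map_add B, ContinuousLinearMap.add_apply, map_add, map_add]
    ring
  rw [hρ0, map_add, hBadd, hDh, hDz, hzre, ← hLevi]
  linarith

end

/-! ### The dimension bound -/

section

/-- The defining function `Re (∑ j k, A_{jk} z_j conj(z_k)) - Im w` of the hyperquadric. -/
noncomputable def quadricFunction {n : ℕ} (A : Matrix (Fin n) (Fin n) ℂ) (Z : CSpace (n + 1)) : ℝ :=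
  (∑ j : Fin n, ∑ k : Fin n, A j k * Z j.castSucc * conj (Z k.castSucc)).re - (Z (Fin.last n)).im

theorem ofReal_quadricFunction {n : ℕ} {A : Matrix (Fin n) (Fin n) ℂ} (hA : A.IsHermitian)
    (Z : CSpace (n + 1)) : (quadricFunction A Z : ℂ) =
      (∑ j : Fin n, ∑ k : Fin n, A j k * Z j.castSucc * conj (Z k.castSucc)) -
        ((Z (Fin.last n)).im : ℂ) := by
  have hreal : conj (∑ j : Fin n, ∑ k : Fin n, A j k * Z j.castSucc * conj (Z k.castSucc)) =
      ∑ j : Fin n, ∑ k : Fin n, A j k * Z j.castSucc * conj (Z k.castSucc) := by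
    simp only [map_sum, map_mul, Complex.conj_conj]
    rw [Finset.sum_comm]
    refine Finset.sum_congr rfl fun j _ => Finset.sum_congr rfl fun k _ => ?_
    rw [← hA.apply j k, RCLike.star_def]
    ring
  rw [quadricFunction, Complex.ofReal_sub, Complex.conj_eq_iff_re.1 hreal]

theorem mem_hyperquadric_iff {n : ℕ} {A : Matrix (Fin n) (Fin n) ℂ} (hA : A.IsHermitian)
    {Z : CSpace (n + 1)} : Z ∈ hyperquadric A ↔ quadricFunction A Z = 0 := by
  rw [← Complex.ofReal_eq_zero, ofReal_quadricFunction hA, sub_eq_zero, eq_comm]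
  rfl

theorem analyticAt_quadricFunction {n : ℕ} (A : Matrix (Fin n) (Fin n) ℂ) (Z : CSpace (n + 1)) :
    AnalyticAt ℝ (quadricFunction A) Z := by
  have hproj : ∀ i, AnalyticAt ℝ (fun Z : CSpace (n + 1) => Z i) Z := fun i =>
    (ContinuousLinearMap.proj (R := ℝ) (φ := fun _ : Fin (n + 1) => ℂ) i).analyticAt Z
  have hconj : ∀ i, AnalyticAt ℝ (fun Z : CSpace (n + 1) => conj (Z i)) Z := fun i =>
    (Complex.conjCLE.toContinuousLinearMap.analyticAt _).comp (hproj i)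
  refine AnalyticAt.sub ?_ ((Complex.imCLM.analyticAt _).comp (hproj _))
  refine (Complex.reCLM.analyticAt _).comp ?_
  exact Finset.analyticAt_fun_sum _ fun j _ => Finset.analyticAt_fun_sum _ fun k _ =>
    (analyticAt_const.mul (hproj _)).mul (hconj _)

theorem fderiv_quadricFunction_ne_zero {n : ℕ} (A : Matrix (Fin n) (Fin n) ℂ)
    (Z : CSpace (n + 1)) : fderiv ℝ (quadricFunction A) Z ≠ 0 := by
  intro h
  have hline : HasDerivAt (fun t : ℝ => Z + t • (Pi.single (Fin.last n) Complex.I : CSpace (n + 1)))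
      (Pi.single (Fin.last n) Complex.I) 0 := by
    simpa using ((hasDerivAt_id (0 : ℝ)).smul_const
      (Pi.single (Fin.last n) Complex.I : CSpace (n + 1))).const_add Z
  have h1 := HasFDerivAt.comp_hasDerivAt (x := (0 : ℝ)) (l := quadricFunction A)
    (l' := fderiv ℝ (quadricFunction A) Z) (hl := by
      simpa using (analyticAt_quadricFunction A Z).differentiableAt.hasFDerivAt) (hf := hline)
  have h2 : (quadricFunction A ∘ fun t : ℝ =>
      Z + t • (Pi.single (Fin.last n) Complex.I : CSpace (n + 1))) =
      fun t : ℝ => quadricFunction A Z - t := by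
    ext t
    simp [quadricFunction]
    ring
  rw [h2, h] at h1
  have h3 : HasDerivAt (fun t : ℝ => quadricFunction A Z - t) (-1) 0 := by
    simpa using (hasDerivAt_id (0 : ℝ)).const_sub (quadricFunction A Z)
  have := h1.unique h3
  norm_num at this

theorem eq_of_two_pow_add_two_pow_eq {i j l : ℕ} (h : 2 ^ i + 2 ^ j = 2 * 2 ^ l) :
    i = l ∧ j = l := by
  rw [← pow_succ'] at h
  have hlt : ∀ {a b : ℕ}, a < b → 2 ^ a + 2 ^ b ≠ 2 ^ (l + 1) := by
    intro a b hab h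
    have h1 : 2 ^ a < 2 ^ b := Nat.pow_lt_pow_right (by norm_num) hab
    have h2 : 0 < 2 ^ a := by positivity
    have h3 : b < l + 1 := (Nat.pow_lt_pow_iff_right (by norm_num : 1 < 2)).1 (by omega)
    have h4 : l + 1 < b + 1 := (Nat.pow_lt_pow_iff_right (by norm_num : 1 < 2)).1
      (by rw [pow_succ 2 b]; omega)
    omega
  rcases lt_trichotomy i j with hij | rfl | hij
  · exact absurd h (hlt hij)
  · rw [← two_mul, ← pow_succ'] at h
    have := Nat.pow_right_injective le_rfl h
    omega
  · exact absurd (by rw [add_comm]; exact h) (hlt hij)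

open Polynomial in
theorem evalEval_modelPolynomial {r : ℕ} (c : ℝ) (ℓ : Fin r → ℝ) (e : Fin r → ℕ) (m k : ℕ)
    (s : ℂ) : (modelPolynomial c (fun i => (ℓ i : ℂ)) e m k).evalEval (conj s) s =
      ((c * (2 * (s ^ (2 * m)).re + ∑ i, ℓ i * ‖s‖ ^ (2 * (m + e i))) ^ k : ℝ) : ℂ) := by
  have h1 : ∀ a, conj s ^ a * s ^ a = ((‖s‖ ^ (2 * a) : ℝ) : ℂ) := by
    intro a
    rw [← mul_pow, mul_comm, Complex.mul_conj, Complex.normSq_eq_norm_sq]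
    push_cast
    rw [← pow_mul]
  have h2 : ((2 * (s ^ (2 * m)).re : ℝ) : ℂ) = conj s ^ (2 * m) + s ^ (2 * m) := by
    rw [← map_pow, add_comm, Complex.add_conj]
  simp only [modelPolynomial, evalEval_mul, evalEval_C, eval_C, evalEval_pow, evalEval_add,
    evalEval_finsetSum, evalEval_X, eval_mul, eval_pow, eval_X]
  rw [Complex.ofReal_mul, Complex.ofReal_pow, Complex.ofReal_add, h2, Complex.ofReal_sum]
  simp only [mul_assoc, h1, Complex.ofReal_mul]
  congr 2
  ring

/-- If a holomorphic map pulls back the defining function of a hyperquadric in `ℂ ^ (n' + 1)` to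
`c * ρ ^ k` to leading order, with `k ≥ 2` and `c ≠ 0`, then `n' ≥ 3 r + 1`, where `r` is the rank
of the Levi form of `ρ = 0`. -/
theorem IsLeviOrthogonal.three_mul_add_one_le {n n' r k : ℕ} {ρ : CSpace n → ℝ} {p : CSpace n}
    {v : Fin r → CSpace n} {ℓ : Fin r → ℝ} {A : Matrix (Fin n') (Fin n') ℂ}
    {H : CSpace n → CSpace (n' + 1)} {c : ℝ} (hv : IsLeviOrthogonal ρ p v ℓ)
    (hρ : AnalyticAt ℝ ρ p) (hρ0 : ρ p = 0) (hd : fderiv ℝ ρ p ≠ 0) (hA : A.IsHermitian)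
    (hH : ∀ j, AnalyticAt ℂ (fun Z => H Z j) p) (hk : 2 ≤ k) (hc : c ≠ 0)
    (hR : (fun q => quadricFunction A (H q) - c * ρ q ^ k) =O[𝓝 p]
      fun q => ‖q - p‖ * ‖ρ q‖ ^ k) :
    3 * r + 1 ≤ n' := by
  obtain ⟨e, he⟩ := exists_holomorphicDifferential_eq_one hd
  -- powers of two keep the exponents of the quadratic monomials apart
  set w : Fin r → ℕ := fun i => 2 ^ (i : ℕ) with hw
  set m := 4 * 2 ^ r + 1 with hm
  have hw1 : ∀ i, 1 ≤ w i := fun i => Nat.one_le_two_pow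
  have hwm : ∀ i, 4 * w i < m := fun i => by
    have : w i < 2 ^ r := Nat.pow_lt_pow_right (by norm_num) i.2
    omega
  have hsidon : ∀ i j l, w i + w j = 2 * w l → i = l ∧ j = l := fun i j l h => by
    have := eq_of_two_pow_add_two_pow_eq h
    exact ⟨Fin.ext this.1, Fin.ext this.2⟩
  set d : Fin r → ℕ := fun i => m + w i with hdd
  have hmd : ∀ i, m ≤ d i := fun i => Nat.le_add_right _ _
  set γ : ℂ → CSpace n := leviCurve p e (fderiv ℝ (fderiv ℝ ρ) p) v d (2 * m) with hγ
  set N := m * (2 * k + 1) with hN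
  have hγO : (fun s => γ s - p) =O[𝓝 0] fun s => ‖s‖ ^ m := isBigO_leviCurve_sub _ hmd
  have hpow0 : ∀ {a : ℕ}, a ≠ 0 → Tendsto (fun s : ℂ => ‖s‖ ^ a) (𝓝 0) (𝓝 0) := fun {a} ha => by
    have := (by fun_prop : Continuous fun s : ℂ => ‖s‖ ^ a).tendsto 0
    simpa [zero_pow ha] using this
  have hγt : Tendsto γ (𝓝 0) (𝓝 p) := by
    have := (hγO.trans_tendsto (hpow0 (by omega))).add_const p
    simpa using this
  have hγc : ContinuousAt γ 0 := (differentiable_leviCurve _ _ _ _ _ _).continuous.continuousAt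
  have hγ0 : γ 0 = p := tendsto_nhds_unique hγc.tendsto hγt
  set μ : ℂ → ℝ := fun s => 2 * (s ^ (2 * m)).re + ∑ i, ℓ i * ‖s‖ ^ (2 * d i) with hμ
  have hμO : μ =O[𝓝 0] fun s => ‖s‖ ^ (2 * m) := by
    refine Asymptotics.IsBigO.add (Asymptotics.IsBigO.const_mul_left ?_ _)
      (Asymptotics.IsBigO.fun_sum fun i _ => Asymptotics.IsBigO.const_mul_left ?_ _)
    · refine Asymptotics.IsBigO.trans (g := fun s : ℂ => s ^ (2 * m)) ?_ (isBigO_pow le_rfl)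
      exact Asymptotics.isBigO_of_le _ fun s => Complex.abs_re_le_norm _
    · exact isBigO_pow_norm_pow (by have := hmd i; omega)
  have hρμ : (fun s => ρ (γ s) - μ s) =O[𝓝 0] fun s => ‖s‖ ^ (3 * m) :=
    hv.isBigO_comp_leviCurve hρ hρ0 he (by omega) hmd
  have hρO : (fun s => ρ (γ s)) =O[𝓝 0] fun s => ‖s‖ ^ (2 * m) :=
    ((hρμ.trans (isBigO_pow_norm_pow (by omega))).add hμO).congr_left fun s => by ring
  have hmain : (fun s => quadricFunction A (H (γ s)) - c * μ s ^ k) =O[𝓝 0] fun s => ‖s‖ ^ N := by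
    have h1 : (fun s => quadricFunction A (H (γ s)) - c * ρ (γ s) ^ k) =O[𝓝 0]
        fun s => ‖s‖ ^ N := by
      refine (hR.comp_tendsto hγt).trans ?_
      refine ((hγO.norm_left).mul ((hρO.norm_left).pow k)).congr_right fun s => ?_
      rw [← pow_mul, ← pow_add, hN]
      congr 1
      ring
    have h2 : (fun s => ρ (γ s) ^ k - μ s ^ k) =O[𝓝 0] fun s => ‖s‖ ^ N := by
      refine (Asymptotics.IsBigO.pow_sub_pow hρμ hρO hμO k).congr_right fun s => ?_
      rw [← pow_mul, ← pow_add, hN]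
      congr 1
      obtain ⟨k', rfl⟩ : ∃ k', k = k' + 2 := ⟨k - 2, by omega⟩
      rw [show k' + 2 - 1 = k' + 1 by omega]
      ring
    exact (h1.add (h2.const_mul_left c)).congr_left fun s => by ring
  have han : ∀ j, AnalyticAt ℂ (fun s => H (γ s) j) 0 := fun j =>
    AnalyticAt.comp (g := fun Z => H Z j) (f := γ) (by rw [hγ0]; exact hH j)
      ((differentiable_leviCurve _ _ _ _ _ _).analyticAt 0)
  choose T hT using fun j : Fin n' => (han j.castSucc).exists_polynomial_isBigO N
  obtain ⟨S, hS⟩ := (han (Fin.last n')).exists_polynomial_isBigO N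
  have hQ : (fun s => (∑ j : Fin n', ∑ k : Fin n', A j k * H (γ s) j.castSucc *
      conj (H (γ s) k.castSucc)) - ((H (γ s) (Fin.last n')).im : ℂ) -
      (modelPolynomial c (fun i => (ℓ i : ℂ)) w m k).evalEval (conj s) s) =O[𝓝 0]
        fun s => ‖s‖ ^ N := by
    have h1 : (fun s => ((quadricFunction A (H (γ s)) - c * μ s ^ k : ℝ) : ℂ)) =O[𝓝 0]
        fun s => ‖s‖ ^ N :=
      Asymptotics.IsBigO.trans (Asymptotics.isBigO_of_le _ fun s => (Complex.norm_real _).le) hmain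
    refine h1.congr_left fun s => ?_
    rw [evalEval_modelPolynomial, Complex.ofReal_sub, ofReal_quadricFunction hA]
  have hpair := fun a b ha hb hab => sum_mul_coeff_mul_conj_coeff_eq (a := a) (b := b)
    (F := fun (j : Fin n') s => H (γ s) j.castSucc) (fun j => (han j.castSucc).continuousAt)
    hT hS hQ ha hb hab
  have := three_mul_add_one_le_card (c := (c : ℂ)) (ℓ := fun i => (ℓ i : ℂ)) (e := w) (m := m)
    (k := k) hA (by exact_mod_cast hc) (fun i => by exact_mod_cast hv.2.2 i) hk hw1 hsidon
    (by omega) hwm (f := fun a j => (T j).coeff a) hpair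
  simpa using this

end

/-! ### Transversality and the theorem -/

section
variable {n n' : ℕ} {M U : Set (CSpace (n + 1))} {H : CSpace (n + 1) → CSpace (n' + 1)}
  {A : Matrix (Fin n') (Fin n') ℂ}

theorem analyticAt_apply_of_differentiableOn (hU : IsOpen U) (hH : DifferentiableOn ℂ H U)
    {p : CSpace (n + 1)} (hp : p ∈ U) (j : Fin (n' + 1)) : AnalyticAt ℂ (fun Z => H Z j) p :=
  ((differentiableOn_pi.1 hH) j).analyticAt_of_finiteDimensional hU hp

theorem analyticAt_quadricFunction_comp (hU : IsOpen U) (hH : DifferentiableOn ℂ H U)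
    {p : CSpace (n + 1)} (hp : p ∈ U) : AnalyticAt ℝ (fun Z => quadricFunction A (H Z)) p :=
  (analyticAt_quadricFunction A (H p)).comp (f := H) (AnalyticAt.pi fun j =>
    (analyticAt_apply_of_differentiableOn hU hH hp j).restrictScalars)

theorem isTransversalAt_of_fderiv_ne_zero (hA : A.IsHermitian) {p : CSpace (n + 1)}
    (hH : DifferentiableAt ℝ H p) (h : fderiv ℝ (fun Z => quadricFunction A (H Z)) p ≠ 0) :
    IsTransversalAt H (hyperquadric A) p := by
  have han := analyticAt_quadricFunction A (H p)
  refine ⟨quadricFunction A, ⟨han, fderiv_quadricFunction_ne_zero A _,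
    Eventually.of_forall fun q => mem_hyperquadric_iff hA⟩, ?_⟩
  have hcomp : fderiv ℝ (fun Z => quadricFunction A (H Z)) p =
      (fderiv ℝ (quadricFunction A) (H p)).comp (fderiv ℝ H p) :=
    fderiv_comp p han.differentiableAt hH
  obtain ⟨w, hw⟩ : ∃ w, fderiv ℝ (quadricFunction A) (H p) (fderiv ℝ H p w) ≠ 0 := by
    by_contra! hcon
    exact h (hcomp.trans (ContinuousLinearMap.ext hcon))
  rw [eq_top_iff]
  intro y _
  set φ := fderiv ℝ (quadricFunction A) (H p) with hφ
  refine Submodule.mem_sup.2 ⟨y - (φ y / φ (fderiv ℝ H p w)) • fderiv ℝ H p w, ?_,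
    (φ y / φ (fderiv ℝ H p w)) • fderiv ℝ H p w, ?_, by abel⟩
  · rw [LinearMap.mem_ker]
    change φ _ = 0
    rw [map_sub, map_smul, smul_eq_mul, div_mul_cancel₀ _ hw, sub_self]
  · exact Submodule.smul_mem _ _ ⟨w, rfl⟩

/-- A map sending a neighborhood of `p` into a hypersurface is not transversal to it at `p`. -/
theorem not_isTransversalAt_of_eventually_mem {m m' : ℕ} {H : CSpace m → CSpace m'}
    {S : Set (CSpace m')} {p : CSpace m} (hH : DifferentiableAt ℝ H p)
    (h : ∀ᶠ q in 𝓝 p, H q ∈ S) : ¬ IsTransversalAt H S p := by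
  rintro ⟨ρ, ⟨hρ, hd, hS⟩, htop⟩
  have hzero : (fun Z => ρ (H Z)) =ᶠ[𝓝 p] fun _ => 0 := by
    filter_upwards [h, hH.continuousAt.eventually hS] with q hq hq' using hq'.1 hq
  have hcomp : fderiv ℝ (fun Z => ρ (H Z)) p = (fderiv ℝ ρ (H p)).comp (fderiv ℝ H p) :=
    fderiv_comp p hρ.differentiableAt hH
  rw [hzero.fderiv_eq, fderiv_fun_const, Pi.zero_apply] at hcomp
  have hle : LinearMap.range (fderiv ℝ H p).toLinearMap ≤
      LinearMap.ker (fderiv ℝ ρ (H p)).toLinearMap := by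
    rintro _ ⟨w, rfl⟩
    exact (DFunLike.congr_fun hcomp w).symm
  rw [sup_eq_left.2 hle] at htop
  refine hd (ContinuousLinearMap.ext fun y => ?_)
  have : y ∈ LinearMap.ker (fderiv ℝ ρ (H p)).toLinearMap := by rw [htop]; trivial
  exact this

theorem isRealAnalyticSubset_fderiv_eq_zero {m : ℕ} {M : Set (CSpace m)} {R : CSpace m → ℝ}
    (hR : ∀ p ∈ M, AnalyticAt ℝ R p) :
    IsRealAnalyticSubset M {q | q ∈ M ∧ fderiv ℝ R q = 0} := by
  refine ⟨fun q hq => hq.1, fun p hp => ⟨1, fun _ q =>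
    ∑ j, (fderiv ℝ R q (Pi.single j 1) ^ 2 + fderiv ℝ R q (Pi.single j Complex.I) ^ 2),
    fun _ => ?_, ?_⟩⟩
  · have h1 : ∀ u : CSpace m, AnalyticAt ℝ (fun q => fderiv ℝ R q u) p := fun u =>
      ((ContinuousLinearMap.apply ℝ ℝ u).analyticAt _).comp (hR p hp).fderiv
    exact Finset.analyticAt_fun_sum _ fun j _ => ((h1 _).pow 2).add ((h1 _).pow 2)
  · refine Eventually.of_forall fun q hq => ?_
    simp only [Set.mem_setOf_eq, hq, true_and, forall_const]
    constructor
    · intro h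
      simp [h]
    · intro h
      rw [Finset.sum_eq_zero_iff_of_nonneg fun j _ => by positivity] at h
      refine ContinuousLinearMap.ext fun v => ?_
      rw [apply_eq_two_mul_re_holomorphicDifferential, sum_smul_single_one v, map_sum]
      rw [Finset.sum_eq_zero fun j _ => ?_]
      · simp
      · have hj := h j (Finset.mem_univ j)
        rw [map_smul, holomorphicDifferential_apply, smul_single_one_eq]
        have h1 : fderiv ℝ R q (Pi.single j 1) = 0 := by nlinarith
        have h2 : fderiv ℝ R q (Pi.single j Complex.I) = 0 := by nlinarith
        simp [h1, h2]

/-- Unique continuation along a connected set: a real-analytic function that vanishes near one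
point of it vanishes near all of them. -/
theorem IsPreconnected.eventuallyEq_zero_of_analyticAt {E : Type*} [NormedAddCommGroup E]
    [NormedSpace ℝ E] {M : Set E} (hM : IsPreconnected M) {R : E → ℝ}
    (hR : ∀ p ∈ M, AnalyticAt ℝ R p) {p₀ : E} (hp₀ : p₀ ∈ M) (h₀ : R =ᶠ[𝓝 p₀] 0) :
    ∀ p ∈ M, R =ᶠ[𝓝 p] 0 := by
  refine hM.subset_of_closure_inter_subset (u := {q | R =ᶠ[𝓝 q] 0}) isOpen_setOf_eventually_nhds
    ⟨p₀, hp₀, h₀⟩ ?_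
  rintro q ⟨hq, hqM⟩
  obtain ⟨δ, hδ, hball⟩ := Metric.eventually_nhds_iff_ball.1 (hR q hqM).eventually_analyticAt
  obtain ⟨q', hq'b, hq'⟩ := mem_closure_iff_nhds.1 hq _ (Metric.ball_mem_nhds q hδ)
  have := (show AnalyticOnNhd ℝ R (Metric.ball q δ) from hball)
    |>.eqOn_zero_of_preconnected_of_eventuallyEq_zero (convex_ball q δ).isPreconnected hq'b hq'
  exact this.eventuallyEq_of_mem (Metric.ball_mem_nhds q hδ)

/-- If `H` is nowhere transversal to the hyperquadric along `M`, then the pulled-back defining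
function vanishes near the points where the Levi form has large rank. -/
theorem eventuallyEq_zero_of_fderiv_eq_zero (hU : IsOpen U) (hMU : M ⊆ U)
    (hA : A.IsHermitian) (hH : DifferentiableOn ℂ H U) {p : CSpace (n + 1)} (hp : p ∈ M) {e₀ : ℕ}
    (hL : LeviZeroEigenvalues M p e₀) (hn : n' ≤ 3 * (n - e₀))
    (h0 : ∀ q ∈ M, quadricFunction A (H q) = 0)
    (h1 : ∀ q ∈ M, fderiv ℝ (fun Z => quadricFunction A (H Z)) q = 0) :
    (fun Z => quadricFunction A (H Z)) =ᶠ[𝓝 p] 0 := by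
  by_contra hne
  obtain ⟨ρ, ⟨hρ, hd, hMρ⟩, u, μ, hu⟩ := exists_isLeviOrthogonal hL
  obtain ⟨e, he⟩ : ∃ e, fderiv ℝ ρ p e ≠ 0 := by
    by_contra! hcon
    exact hd (ContinuousLinearMap.ext hcon)
  have hρ0 : ρ p = 0 := hMρ.self_of_nhds.1 hp
  have hec : ContinuousAt (fun q => fderiv ℝ ρ q e) p := by
    have := hρ.fderiv.continuousAt
    fun_prop
  have hW : ∀ᶠ q in 𝓝 p, AnalyticAt ℝ ρ q ∧ (∃ v ℓ, IsLeviOrthogonal (r := n - e₀) ρ q v ℓ) ∧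
      q ∈ U ∧ fderiv ℝ ρ q e ≠ 0 ∧ ∀ᶠ x in 𝓝 q, x ∈ M ↔ ρ x = 0 :=
    hρ.eventually_analyticAt.and ((hu.eventually_exists hρ hd).and
      ((hU.eventually_mem (hMU hp)).and ((hec.eventually_ne he).and
        (eventually_eventually_nhds.2 hMρ))))
  obtain ⟨p', ⟨hρ', ⟨v, ℓ, hv⟩, hpU, he', hMρ'⟩, hρ0', k, hkne, hkvan⟩ :=
    (analyticAt_quadricFunction_comp hU hH (hMU hp)).exists_order_along hW hρ hρ0 he hne
  have hpM : p' ∈ M := hMρ'.self_of_nhds.2 hρ0'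
  have hk : 2 ≤ k := by
    rcases k with _ | _ | k
    · exact absurd (h0 p' hpM) hkne
    · refine absurd ?_ hkne
      rw [iteratedDirDeriv_succ]
      exact DFunLike.congr_fun (h1 p' hpM) e
    · omega
  obtain ⟨c, hc, hO⟩ := (analyticAt_quadricFunction_comp hU hH hpU).exists_isBigO_sub_mul_pow
    (by omega) hρ' hρ0' he' hkvan hkne
  have := hv.three_mul_add_one_le hρ' hρ0' (fun h => he' (by rw [h]; rfl)) hA
    (analyticAt_apply_of_differentiableOn hU hH hpU) hk hc hO
  omega

end

theorem theorem1p3 {n n' : ℕ} (M U : Set (CSpace (n + 1))) (M' : Set (CSpace (n' + 1)))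
    (hM : IsRealAnalyticHypersurface M) (hMconn : IsConnected M)
    (hU : IsOpen U) (hMU : M ⊆ U)
    (hM' : IsNondegenerateHyperquadric M')
    (hn : ∃ p ∈ M, ∃ e₀ : ℕ, LeviZeroEigenvalues M p e₀ ∧ (n' : ℤ) ≤ 3 * ((n : ℤ) - (e₀ : ℤ)))
    (H : CSpace (n + 1) → CSpace (n' + 1)) (hH : DifferentiableOn ℂ H U)
    (hHM : Set.MapsTo H M M') :
    Xor
      (∃ V : Set (CSpace (n + 1)), IsOpen V ∧ V ⊆ U ∧ M ⊆ V ∧ Set.MapsTo H V M')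
      (∃ A : Set (CSpace (n + 1)), IsRealAnalyticSubset M A ∧ A ≠ M ∧
        ∀ p ∈ M, p ∉ A → IsTransversalAt H M' p) := by
  obtain ⟨A, hA, -, rfl⟩ := hM'
  have hHd : ∀ p ∈ M, DifferentiableAt ℝ H p := fun p hp =>
    (hH.differentiableAt (hU.mem_nhds (hMU hp))).restrictScalars ℝ
  set R : CSpace (n + 1) → ℝ := fun Z => quadricFunction A (H Z) with hR
  have hRan : ∀ p ∈ M, AnalyticAt ℝ R p := fun p hp =>
    analyticAt_quadricFunction_comp hU hH (hMU hp)
  have hexcl : ¬ ((∃ V : Set (CSpace (n + 1)), IsOpen V ∧ V ⊆ U ∧ M ⊆ V ∧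
      Set.MapsTo H V (hyperquadric A)) ∧ ∃ A' : Set (CSpace (n + 1)), IsRealAnalyticSubset M A' ∧
        A' ≠ M ∧ ∀ p ∈ M, p ∉ A' → IsTransversalAt H (hyperquadric A) p) := by
    rintro ⟨⟨V, hV, -, hMV, hHV⟩, A', ⟨hA'M, -⟩, hne, htrans⟩
    obtain ⟨p, hp, hpA⟩ := Set.exists_of_ssubset (hA'M.ssubset_of_ne hne)
    exact not_isTransversalAt_of_eventually_mem (hHd p hp)
      ((hV.eventually_mem (hMV hp)).mono fun q hq => hHV hq) (htrans p hp hpA)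
  by_cases hall : {q | q ∈ M ∧ fderiv ℝ R q = 0} = M
  · have hi : ∃ V : Set (CSpace (n + 1)), IsOpen V ∧ V ⊆ U ∧ M ⊆ V ∧
        Set.MapsTo H V (hyperquadric A) := by
      obtain ⟨p, hp, e₀, hL, hle⟩ := hn
      have hzero := hMconn.isPreconnected.eventuallyEq_zero_of_analyticAt hRan hp
        (eventuallyEq_zero_of_fderiv_eq_zero hU hMU hA hH hp hL (by omega)
          (fun q hq => (mem_hyperquadric_iff hA).1 (hHM hq))
          (fun q hq => (hall.symm ▸ hq : q ∈ {q | q ∈ M ∧ fderiv ℝ R q = 0}).2))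
      exact ⟨U ∩ {q | R =ᶠ[𝓝 q] 0}, hU.inter isOpen_setOf_eventually_nhds,
        Set.inter_subset_left, fun q hq => ⟨hMU hq, hzero q hq⟩,
        fun q hq => (mem_hyperquadric_iff hA).2 hq.2.self_of_nhds⟩
    exact Or.inl ⟨hi, fun h => hexcl ⟨hi, h⟩⟩
  · have hii : ∃ A' : Set (CSpace (n + 1)), IsRealAnalyticSubset M A' ∧
        A' ≠ M ∧ ∀ p ∈ M, p ∉ A' → IsTransversalAt H (hyperquadric A) p :=
      ⟨_, isRealAnalyticSubset_fderiv_eq_zero hRan, hall, fun p hp hpA =>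
        isTransversalAt_of_fderiv_ne_zero hA (hHd p hp) fun h => hpA ⟨hp, h⟩⟩
    exact Or.inr ⟨hii, fun h => hexcl ⟨h, hii⟩⟩
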